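/- Let $M$ be a closed surface, that is, a compact Hausdorff smooth $2$-manifold without boundary, and let $\omega$ be an area form on $M$, that is, a smooth nowhere vanishing $2$-form; $M$ is oriented by $\omega$ and $\mathrm{area}(M)=\int_M\omega$. Let $C(M)$ be the algebra of continuous real functions on $M$, and for $F\in C(M)$ put $C(F)=\{\varphi\circ F : \varphi\in C(\operatorname{im}F)\}$. Let $\zeta\colon C(M)\to\mathbb{R}$ be a simple quasi-state: $\zeta(F)\ge 0$ whenever $F\ge 0$, $\zeta(1)=1$, and for every $F\in C(M)$ the restriction of $\zeta$ to $C(F)$ is linear and multiplicative. Then for all $F,G\in C^\infty(M)$, \[ \Pi(F,G)^2\le \mathrm{area}(M)\,\|\{F,G\}\|, \] where $\Pi(F,G)=|\zeta(F+G)-\zeta(F)-\zeta(G)|$, the Poisson bracket $\{F,G\}$ is the function defined by $-dF\wedge dG=\{F,G\}\,\omega$, and $\|\cdot\|$ is the supremum norm. -/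

import Mathlib

open scoped Manifold ContDiff Topology
open MeasureTheory

noncomputable section

namespace SimpleQuasiState

section QuasiStates

variable {X : Type*} [TopologicalSpace X]

/-- The closed subalgebra `C(F) = {φ ∘ F | φ ∈ C(im F)}` of `C(X)` generated by `F` and `1`. -/
def generatedBy (F : C(X, ℝ)) : Set C(X, ℝ) :=
  {H | ∃ φ : C(Set.range F, ℝ), ∀ x, H x = φ ⟨F x, Set.mem_range_self x⟩}

/-- A quasi-state on `X`: a functional on `C(X)` that is positive, linear on every singly generated
subalgebra `C(F)`, and normalized. -/
structure IsQuasiState (ζ : C(X, ℝ) → ℝ) : Prop where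
  nonneg : ∀ F : C(X, ℝ), 0 ≤ F → 0 ≤ ζ F
  linear : ∀ F : C(X, ℝ), ∀ H ∈ generatedBy F, ∀ K ∈ generatedBy F, ∀ a b : ℝ,
    ζ (a • H + b • K) = a * ζ H + b * ζ K
  map_one : ζ 1 = 1

/-- A quasi-state is simple if it is multiplicative on every `C(F)`. -/
structure IsSimple (ζ : C(X, ℝ) → ℝ) : Prop extends IsQuasiState ζ where
  multiplicative : ∀ F : C(X, ℝ), ∀ H ∈ generatedBy F, ∀ K ∈ generatedBy F,
    ζ (H * K) = ζ H * ζ K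

/-- The measure of non-additivity `Π(F, G) = |ζ(F + G) - ζ(F) - ζ(G)|`. -/
def nonadditivity (ζ : C(X, ℝ) → ℝ) (F G : C(X, ℝ)) : ℝ :=
  |ζ (F + G) - ζ F - ζ G|

end QuasiStates

/-- The model plane `ℝ²`. -/
abbrev Plane : Type := EuclideanSpace ℝ (Fin 2)

/-- The standard basis vectors of `ℝ²`. -/
def stdVec (i : Fin 2) : Plane := EuclideanSpace.single i (1 : ℝ)

section Surface

variable {M : Type*} [TopologicalSpace M] [ChartedSpace Plane M]

/-- The coefficient `a` of a 2-form `σ` in the chart at `p`: in the coordinates of that chart,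
`σ = a dx₁ ∧ dx₂`, i.e. `a = σ(∂₁, ∂₂)`. It is meaningful on the target of the chart. -/
def localCoeff (σ : ∀ x : M, TangentSpace (𝓡 2) x [⋀^Fin 2]→L[ℝ] ℝ) (p : M) (y : Plane) : ℝ :=
  σ ((extChartAt (𝓡 2) p).symm y)
    (fun i => mfderiv 𝓘(ℝ, Plane) (𝓡 2) (extChartAt (𝓡 2) p).symm y (stdVec i))

variable (M) in
/-- An area form on a surface: a smooth nowhere vanishing differential 2-form. -/
structure AreaForm where
  /-- the alternating form on each tangent plane -/
  form : ∀ x : M, TangentSpace (𝓡 2) x [⋀^Fin 2]→L[ℝ] ℝ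
  smooth : ∀ p : M, ContDiffOn ℝ ∞ (localCoeff form p) (extChartAt (𝓡 2) p).target
  ne_zero : ∀ x : M, form x ≠ 0

/-- The value `(dF ∧ dG)_x (v, w)`. -/
def wedgeDiff (F G : M → ℝ) (x : M) (v w : TangentSpace (𝓡 2) x) : ℝ :=
  let dF : TangentSpace (𝓡 2) x →L[ℝ] ℝ := mfderiv (𝓡 2) 𝓘(ℝ, ℝ) F x
  let dG : TangentSpace (𝓡 2) x →L[ℝ] ℝ := mfderiv (𝓡 2) 𝓘(ℝ, ℝ) G x
  dF v * dG w - dF w * dG v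

/-- The Poisson bracket, i.e. the function with `-dF ∧ dG = {F, G} σ`
(see `neg_wedgeDiff_eq`). -/
def poissonBracket (σ : AreaForm M) (F G : M → ℝ) (x : M) : ℝ :=
  -wedgeDiff F G x (stdVec 0) (stdVec 1) / σ.form x ![stdVec 0, stdVec 1]

theorem form_eq (A : Plane [⋀^Fin 2]→L[ℝ] ℝ) (v w : Plane) :
    A ![v, w] = (v 0 * w 1 - v 1 * w 0) * A ![stdVec 0, stdVec 1] := by
  have hv : ∀ u : Plane, u = u 0 • stdVec 0 + u 1 • stdVec 1 := by
    intro u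
    ext i
    fin_cases i <;> simp [stdVec]
  have add0 : ∀ a b c : Plane, A ![a + b, c] = A ![a, c] + A ![b, c] := fun a b c => by
    simpa using A.toMultilinearMap.cons_add ![c] a b
  have smul0 : ∀ (r : ℝ) (a c : Plane), A ![r • a, c] = r * A ![a, c] := fun r a c => by
    simpa using A.toMultilinearMap.cons_smul ![c] r a
  have swap : ∀ a b : Plane, A ![a, b] = -A ![b, a] := fun a b => by
    have h := A.toAlternatingMap.map_swap ![b, a] (i := 0) (j := 1) (by decide)
    have e : (![b, a] ∘ Equiv.swap (0 : Fin 2) 1) = ![a, b] := by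
      ext i : 1
      fin_cases i <;> simp
    rw [e] at h
    exact h
  have self : ∀ a : Plane, A ![a, a] = 0 := fun a => by linarith [swap a a]
  have expand : ∀ (u c : Plane), A ![u, c] = u 0 * A ![stdVec 0, c] + u 1 * A ![stdVec 1, c] := by
    intro u c
    conv_lhs => rw [hv u]
    rw [add0, smul0, smul0]
  rw [expand v w, swap _ w, swap _ w, expand w, expand w, self, self, swap (stdVec 1) (stdVec 0)]
  ring

theorem neg_wedgeDiff_eq (σ : AreaForm M) (F G : M → ℝ) (x : M) (v w : TangentSpace (𝓡 2) x) :
    -wedgeDiff F G x v w = poissonBracket σ F G x * σ.form x ![v, w] := by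
  have hne : (show Plane [⋀^Fin 2]→L[ℝ] ℝ from σ.form x) ![stdVec 0, stdVec 1] ≠ 0 := by
    intro h0
    apply σ.ne_zero x
    ext u
    have hu : u = ![u 0, u 1] := by
      ext i : 1
      fin_cases i <;> rfl
    rw [hu]
    exact (form_eq (σ.form x) (u 0) (u 1)).trans (by rw [h0]; simp)
  have hlin : ∀ (α : Plane →L[ℝ] ℝ) (u : Plane),
      α u = u 0 * α (stdVec 0) + u 1 * α (stdVec 1) := by
    intro α u
    have hv : u = u 0 • stdVec 0 + u 1 • stdVec 1 := by
      ext i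
      fin_cases i <;> simp [stdVec]
    conv_lhs => rw [hv]
    simp
  have key : ∀ (α β : Plane →L[ℝ] ℝ) (A : Plane [⋀^Fin 2]→L[ℝ] ℝ) (v w : Plane),
      A ![stdVec 0, stdVec 1] ≠ 0 →
      -(α v * β w - α w * β v) =
        -(α (stdVec 0) * β (stdVec 1) - α (stdVec 1) * β (stdVec 0)) /
          A ![stdVec 0, stdVec 1] * A ![v, w] := by
    intro α β A v w h
    rw [form_eq A v w, hlin α v, hlin α w, hlin β v, hlin β w]
    field_simp
    ring
  exact key (mfderiv (𝓡 2) 𝓘(ℝ, ℝ) F x) (mfderiv (𝓡 2) 𝓘(ℝ, ℝ) G x) (σ.form x) v w hne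

/-- The supremum norm of a function on `M`. -/
def supNorm (f : M → ℝ) : ℝ := ⨆ x : M, |f x|

variable [T2Space M] [CompactSpace M] [IsManifold (𝓡 2) ∞ M]

variable (M) in
theorem exists_chartPartition : ∃ ρ : SmoothPartitionOfUnity M (𝓡 2) M Set.univ,
    ρ.IsSubordinate fun p => (extChartAt (𝓡 2) p).source :=
  SmoothPartitionOfUnity.exists_isSubordinate (𝓡 2) isClosed_univ _
    (fun p => isOpen_extChartAt_source p)
    (fun p _ => Set.mem_iUnion.2 ⟨p, mem_extChartAt_source p⟩)

variable (M) in
/-- A smooth partition of unity subordinate to the cover of `M` by the charts `extChartAt p`. -/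
def chartPartition : SmoothPartitionOfUnity M (𝓡 2) M Set.univ :=
  (exists_chartPartition M).choose

/-- `area(M) = ∫_M σ`, where `M` carries the orientation defined by `σ`. As usual, the integral is
computed with a partition of unity (the value does not depend on it) subordinate to coordinate charts.
Since `σ` is positive for the orientation, a chart with local coefficient `a` contributes the
integral of `|a|` (if the chart reverses orientation, the sign changes). -/
def area (σ : AreaForm M) : ℝ :=
  ∑ᶠ p : M, ∫ y in (extChartAt (𝓡 2) p).target,
    chartPartition M p ((extChartAt (𝓡 2) p).symm y) * |localCoeff σ.form p y|

end Surface

end SimpleQuasiState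

end

/-! Let `d = ζ(F + G) - ζ F - ζ G`. As `ζ` is odd and the bracket is unchanged under `(F, G) ↦ (-F,
-G)`, one may assume `d ≥ 0`. The proof compares the area of a plane triangle with the area swept
out by the map `Φ = (F, G) : M → ℝ²`.

The topological half is that `Φ` covers the open triangle `T` cut out by `ζ F < s`, `ζ G < t`, `s +
t < ζ(F + G)`, whose area is `d² / 2`. A simple quasi-state acts on each `C(F)` as evaluation at `ζ
F` (`map_comp`), and the level sets `{F = ζ F}`, `{G = ζ G}` always meet (`exists_eq_and_eq`). If
`Φ` missed a point of `T`, three functions with zero sum and no common zero would all have negative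
value under `ζ`. Normalizing their negative parts gives a partition of unity with values in the
boundary of a simplex, and the meeting property rules this out (`exists_eq_zero_of_add_eq_zero`).

The analytic half is that `Φ` has degree zero, since `dF ∧ dG` is exact on a closed surface. Here
this says that the positive and negative parts of `{F, G} |σ|` have the same image under `Φ`
(`positivePush_eq`): by Stokes all Fourier coefficients of their difference vanish. So whatever is
covered is covered twice, counted with area, and `2 · vol T ≤ ∫ |{F, G}|` (`two_mul_volume_le`). The
right side is at most `area(M) ‖{F, G}‖`, while the left side is `d²`. -/

noncomputable section

namespace SimpleQuasiState

/-! ### Simple quasi-states and the covering of the triangle -/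

section QuasiStates

variable {X : Type*} [TopologicalSpace X]

theorem comp_mem_generatedBy (F : C(X, ℝ)) (φ : C(ℝ, ℝ)) : φ.comp F ∈ generatedBy F :=
  ⟨φ.restrict _, fun _ => rfl⟩

theorem self_mem_generatedBy (F : C(X, ℝ)) : F ∈ generatedBy F :=
  comp_mem_generatedBy F (ContinuousMap.id ℝ)

namespace IsSimple

variable {ζ : C(X, ℝ) → ℝ} (hζ : IsSimple ζ)
include hζ

/-- Nonnegative functions with disjoint supports lie in a common singly generated subalgebra. -/
theorem mul_eq_zero_of_disjoint {f g : C(X, ℝ)} (hf : 0 ≤ f) (hg : 0 ≤ g) (h : f * g = 0) :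
    ζ f * ζ g = 0 := by
  have h0 : ∀ x, f x = 0 ∨ g x = 0 := fun x => by
    simpa using congrArg (fun k : C(X, ℝ) => k x) h
  have hf' : ∀ x, 0 ≤ f x := hf
  have hg' : ∀ x, 0 ≤ g x := hg
  -- Disjointness makes `f` and `g` the positive and negative parts of `f - g`, so `ζ` is
  -- multiplicative on this pair.
  have h1 : f ∈ generatedBy (f - g) := by
    convert comp_mem_generatedBy (f - g) ⟨fun t => max t 0, by fun_prop⟩ using 1
    ext x
    rcases h0 x with h | h
    · simp [h, hg' x]
    · simp [h, hf' x]
  have h2 : g ∈ generatedBy (f - g) := by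
    convert comp_mem_generatedBy (f - g) ⟨fun t => max (-t) 0, by fun_prop⟩ using 1
    ext x
    rcases h0 x with h | h
    · simp [h, hg' x]
    · simp [h, hf' x]
  have hz : ζ (0 : C(X, ℝ)) = 0 := by
    simpa using hζ.linear 1 1 (self_mem_generatedBy 1) 1 (self_mem_generatedBy 1) 0 0
  rw [← hζ.multiplicative _ _ h1 _ h2, h, hz]

/-- A simple quasi-state restricts to the evaluation at `ζ F` on the functions of `F`. -/
theorem map_comp (F : C(X, ℝ)) (φ : C(ℝ, ℝ)) : ζ (φ.comp F) = φ (ζ F) := by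
  have lin : ∀ φ ψ : C(ℝ, ℝ), ∀ a b : ℝ,
      ζ ((a • φ + b • ψ).comp F) = a * ζ (φ.comp F) + b * ζ (ψ.comp F) := fun φ ψ a b =>
    hζ.linear F _ (comp_mem_generatedBy F φ) _ (comp_mem_generatedBy F ψ) a b
  have mul : ∀ φ ψ : C(ℝ, ℝ), ζ ((φ * ψ).comp F) = ζ (φ.comp F) * ζ (ψ.comp F) := fun φ ψ =>
    hζ.multiplicative F _ (comp_mem_generatedBy F φ) _ (comp_mem_generatedBy F ψ)
  have one : ζ ((1 : C(ℝ, ℝ)).comp F) = 1 := hζ.map_one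
  by_contra hne
  have sub : ∀ (ψ : C(ℝ, ℝ)) (c : ℝ), ζ ((ψ - ContinuousMap.const ℝ c).comp F) =
      ζ (ψ.comp F) - c := fun ψ c => by
    have h := lin ψ 1 1 (-c)
    rw [one] at h
    have e : (1 : ℝ) • ψ + (-c) • (1 : C(ℝ, ℝ)) = ψ - ContinuousMap.const ℝ c := by
      ext t; simp; ring
    rw [e] at h
    linarith
  -- Both `u` and `v` are killed by `ζ`, hence so is `u² + v²`. A common zero would force `φ (ζ F) =
  -- ζ (φ ∘ F)`, so under `hne` the sum of squares is invertible, contradicting `ζ 1 = 1`.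
  set u : C(ℝ, ℝ) := ContinuousMap.id ℝ - ContinuousMap.const ℝ (ζ F) with hu
  set v : C(ℝ, ℝ) := φ - ContinuousMap.const ℝ (ζ (φ.comp F)) with hv
  have hu0 : ζ (u.comp F) = 0 := by
    rw [hu, sub]; exact sub_self _
  have hv0 : ζ (v.comp F) = 0 := by rw [hv, sub, sub_self]
  have hw0 : ζ ((u * u + v * v).comp F) = 0 := by
    have h := lin (u * u) (v * v) 1 1
    rw [mul, mul, hu0, hv0, one_smul, one_smul] at h
    simpa using h
  have hpos : ∀ t, (u * u + v * v) t ≠ 0 := by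
    intro t ht
    have h1 : u t = 0 ∧ v t = 0 := by
      simp only [ContinuousMap.add_apply, ContinuousMap.mul_apply] at ht
      constructor <;> nlinarith [mul_self_nonneg (u t), mul_self_nonneg (v t)]
    obtain ⟨h1, h2⟩ := h1
    have e1 : t = ζ F := by simpa [hu, sub_eq_zero] using h1
    have e2 : φ t = ζ (φ.comp F) := by simpa [hv, sub_eq_zero] using h2
    exact hne (by rw [← e2, e1])
  have h := mul (u * u + v * v) ⟨fun t => ((u * u + v * v) t)⁻¹,
    (map_continuous (u * u + v * v)).inv₀ hpos⟩
  have e : (u * u + v * v) * ⟨fun t => ((u * u + v * v) t)⁻¹,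
      (map_continuous (u * u + v * v)).inv₀ hpos⟩ = (1 : C(ℝ, ℝ)) := by
    ext t
    exact mul_inv_cancel₀ (hpos t)
  rw [e, one, hw0, zero_mul] at h
  exact one_ne_zero h

theorem map_neg (F : C(X, ℝ)) : ζ (-F) = -ζ F := by
  have h := hζ.map_comp F ⟨fun t => -t, by fun_prop⟩
  exact h

theorem map_sub_const (F : C(X, ℝ)) (c : ℝ) : ζ (F - ContinuousMap.const X c) = ζ F - c :=
  hζ.map_comp F ⟨fun t => t - c, by fun_prop⟩

variable [CompactSpace X]

/-- The level sets on which a simple quasi-state concentrates meet pairwise. -/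
theorem exists_eq_and_eq (F G : C(X, ℝ)) : ∃ x, F x = ζ F ∧ G x = ζ G := by
  by_contra hcon
  push Not at hcon
  -- A zero of `u` is a common point of the two level sets. Without one, compactness gives `u ≥ 2ε`.
  let u : C(X, ℝ) := ⟨fun x => |F x - ζ F| + |G x - ζ G|, by fun_prop⟩
  have hu : ∀ x, 0 < u x := fun x => by
    show 0 < |F x - ζ F| + |G x - ζ G|
    by_cases h : F x = ζ F
    · have := abs_pos.2 (sub_ne_zero.2 (hcon x h))
      positivity
    · have := abs_pos.2 (sub_ne_zero.2 h)
      positivity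
  obtain ⟨ε, hε, hεu⟩ : ∃ ε > 0, ∀ x, 2 * ε ≤ u x := by
    rcases isEmpty_or_nonempty X with hX | hX
    · exact ⟨1, one_pos, fun x => hX.elim x⟩
    · obtain ⟨x₀, -, h₀⟩ := isCompact_univ.exists_isMinOn Set.univ_nonempty
        (map_continuous u).continuousOn
      exact ⟨u x₀ / 2, by linarith [hu x₀], fun x => by
        have := h₀ (Set.mem_univ x)
        simp only [Set.mem_ofPred_eq] at this
        linarith⟩
  -- Bumps of height and radius `ε` about `ζ F` and `ζ G`: a point in both supports' interiors would
  -- have `u < 2ε`, so the product is zero although `ζ` takes the value `ε` on each factor.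
  let bump : ℝ → C(ℝ, ℝ) := fun a => ⟨fun t => max (ε - |t - a|) 0, by fun_prop⟩
  have hb : ∀ H : C(X, ℝ), ζ ((bump (ζ H)).comp H) = ε := fun H => by
    rw [hζ.map_comp]
    simp [bump, hε.le]
  have h := hζ.mul_eq_zero_of_disjoint (f := (bump (ζ F)).comp F) (g := (bump (ζ G)).comp G)
    (fun x => le_max_right _ _) (fun x => le_max_right _ _) (by
      ext x
      have := hεu x
      simp only [u, ContinuousMap.coe_mk] at this
      simp only [bump, ContinuousMap.mul_apply, ContinuousMap.comp_apply, ContinuousMap.coe_mk,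
        ContinuousMap.zero_apply, mul_eq_zero, max_eq_right_iff]
      by_contra! hc
      linarith [hc.1, hc.2])
  rw [hb, hb] at h
  nlinarith

/-- If three functions have no common zero and sum to zero, a simple quasi-state cannot be negative
on all of them. -/
theorem exists_eq_zero_of_add_eq_zero {f g h : C(X, ℝ)} (hsum : f + g + h = 0)
    (hf : ζ f < 0) (hg : ζ g < 0) (hh : ζ h < 0) : ∃ x, f x = 0 ∧ g x = 0 := by
  by_contra hcon
  push Not at hcon
  have hs : ∀ x, f x + g x + h x = 0 := fun x => congrArg (fun k : C(X, ℝ) => k x) hsum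
  -- The negative parts vanish together only where all three functions are nonnegative, hence zero
  -- because their sum is. Dividing by `N` turns them into a partition of unity.
  let N : X → ℝ := fun x => max (-f x) 0 + max (-g x) 0 + max (-h x) 0
  have hN : ∀ x, 0 < N x := by
    intro x
    have h1 := hs x
    have h2 := hcon x
    by_contra hle
    have l1 := le_max_left (-f x) 0
    have l2 := le_max_left (-g x) 0
    have l3 := le_max_left (-h x) 0
    have r1 := le_max_right (-f x) 0
    have r2 := le_max_right (-g x) 0
    have r3 := le_max_right (-h x) 0
    simp only [N] at hle
    exact h2 (by linarith) (by linarith)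
  have hNc : Continuous N := by fun_prop
  let nrm : C(X, ℝ) → C(X, ℝ) := fun k =>
    ⟨fun x => max (-k x) 0 / N x, by
      exact Continuous.div (by fun_prop) hNc fun x => (hN x).ne'⟩
  have hnn : ∀ k x, 0 ≤ nrm k x := fun k x => div_nonneg (le_max_right _ _) (hN x).le
  have hpos : ∀ k : C(X, ℝ), ζ k < 0 → 0 < ζ (nrm k) := by
    intro k hk
    obtain ⟨x, h1, h2⟩ := hζ.exists_eq_and_eq k (nrm k)
    rw [← h2]
    refine div_pos (lt_max_of_lt_left ?_) (hN x)
    linarith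
  have hsum1 : ∀ x, nrm f x + nrm g x + nrm h x = 1 := by
    intro x
    show max (-f x) 0 / N x + max (-g x) 0 / N x + max (-h x) 0 / N x = 1
    rw [← add_div, ← add_div]
    exact div_self (hN x).ne'
  -- Three numbers with zero sum are not all negative.
  have hzero : ∀ x, nrm f x = 0 ∨ nrm g x = 0 ∨ nrm h x = 0 := by
    intro x
    by_cases h1 : 0 ≤ f x
    · left; show max (-f x) 0 / N x = 0
      rw [max_eq_right (by linarith), zero_div]
    by_cases h2 : 0 ≤ g x
    · right; left; show max (-g x) 0 / N x = 0
      rw [max_eq_right (by linarith), zero_div]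
    · right; right; show max (-h x) 0 / N x = 0
      rw [max_eq_right (by linarith [hs x]), zero_div]
  have pa := hpos f hf
  have pb := hpos g hg
  have pc := hpos h hh
  -- At a point where two members take their positive `ζ`-values the third must vanish, so each two
  -- `ζ`-values add up to 1, and all three equal 1/2.
  obtain ⟨x, hx1, hx2⟩ := hζ.exists_eq_and_eq (nrm f) (nrm g)
  obtain ⟨y, hy1, hy2⟩ := hζ.exists_eq_and_eq (nrm f) (nrm h)
  obtain ⟨z, hz1, hz2⟩ := hζ.exists_eq_and_eq (nrm g) (nrm h)
  have sx := hsum1 x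
  have sy := hsum1 y
  have sz := hsum1 z
  have ex : ζ (nrm f) + ζ (nrm g) = 1 := by
    rcases hzero x with h | h | h <;> linarith
  have ey : ζ (nrm f) + ζ (nrm h) = 1 := by
    rcases hzero y with h | h | h <;> linarith
  have ez : ζ (nrm g) + ζ (nrm h) = 1 := by
    rcases hzero z with h | h | h <;> linarith
  -- The members now take values 1/2, 1/2, 0 in some order at each of `t`, `v`, `w`. So `ζ (nrm f -
  -- nrm h)` lies in `{0, 1/2}`, in `{1/2, -1/2}` and in `{0, -1/2}`, which have no common element.
  obtain ⟨t, ht, ht'⟩ := hζ.exists_eq_and_eq (nrm f) (nrm f - nrm h)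
  obtain ⟨v, hv, hv'⟩ := hζ.exists_eq_and_eq (nrm g) (nrm f - nrm h)
  obtain ⟨w, hw, hw'⟩ := hζ.exists_eq_and_eq (nrm h) (nrm f - nrm h)
  rw [ContinuousMap.sub_apply] at ht' hv' hw'
  have st := hsum1 t
  have sv := hsum1 v
  have sw := hsum1 w
  rcases hzero t with h | h | h <;> rcases hzero v with h' | h' | h' <;>
    rcases hzero w with h'' | h'' | h'' <;> linarith

/-- If `ζ (F + G) > ζ F + ζ G`, the map `(F, G)` covers the triangle bounded by the three lines
on which `ζ` concentrates. -/
theorem exists_eq_of_mem_triangle (F G : C(X, ℝ)) {s t : ℝ} (hs : ζ F < s) (ht : ζ G < t)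
    (hst : s + t < ζ (F + G)) : ∃ x, F x = s ∧ G x = t := by
  have h3 : ζ (-(F + G - ContinuousMap.const X (s + t))) < 0 := by
    rw [hζ.map_neg, hζ.map_sub_const]; linarith
  obtain ⟨x, h1, h2⟩ := hζ.exists_eq_zero_of_add_eq_zero
    (f := F - ContinuousMap.const X s) (g := G - ContinuousMap.const X t)
    (h := -(F + G - ContinuousMap.const X (s + t)))
    (by ext x; simp; ring) (by rw [hζ.map_sub_const]; linarith)
    (by rw [hζ.map_sub_const]; linarith) h3
  exact ⟨x, by simpa [sub_eq_zero] using h1, by simpa [sub_eq_zero] using h2⟩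

end IsSimple

end QuasiStates

/-! ### Stokes' theorem in the plane -/

section PlaneCalculus

/-- The Jacobian determinant of the pair `(k, g)` of functions on the plane. -/
def planeJacobian (k g : Plane → ℝ) (y : Plane) : ℝ :=
  fderiv ℝ k y (stdVec 0) * fderiv ℝ g y (stdVec 1) -
    fderiv ℝ k y (stdVec 1) * fderiv ℝ g y (stdVec 0)

theorem integral_fderiv_apply_eq_zero {V : Plane → ℝ} (hV : ContDiff ℝ 1 V)
    (hc : HasCompactSupport V) (v : Plane) : ∫ y, fderiv ℝ V y v = 0 := by
  have hcont : Continuous fun y => fderiv ℝ V y v :=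
    (hV.continuous_fderiv one_ne_zero).clm_apply continuous_const
  have hint : Integrable fun y => fderiv ℝ V y v :=
    hcont.integrable_of_hasCompactSupport (hc.fderiv_apply ℝ v)
  have h := integral_mul_fderiv_eq_neg_fderiv_mul_of_integrable (𝕜 := ℝ) (μ := volume)
    (f := fun _ : Plane => (1 : ℝ)) (g := V) (v := v) (by simp) (by simpa using hint)
    (by simpa using hV.continuous.integrable_of_hasCompactSupport hc)
    (fun x _ => differentiableAt_const _) (fun x _ => hV.differentiable one_ne_zero x)
  simpa using h

/-- Stokes' theorem for `s dk ∧ dg` on an open set `U`, where `k` has compact support in `U` and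
`s` is locally constant. -/
theorem setIntegral_planeJacobian_eq_zero {U K : Set Plane} (hU : IsOpen U) (hK : IsCompact K)
    (hKU : K ⊆ U) {k g s : Plane → ℝ} (hk : ContDiffOn ℝ ∞ k U) (hg : ContDiffOn ℝ ∞ g U)
    (hk0 : ∀ y ∈ U, y ∉ K → k y = 0) (hs : ∀ y ∈ U, ∀ᶠ z in 𝓝 y, s z = s y) :
    ∫ y in U, s y * planeJacobian k g y = 0 := by
  -- The values on `v` of the 1-form `s k dg`, extended by zero. It is `C¹` because `s` is locally
  -- constant and `k` vanishes off `K`. Its exterior derivative is `s dk ∧ dg`, the second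
  -- derivatives of `g` cancelling by symmetry.
  let V : Plane → Plane → ℝ := fun v => U.indicator fun y => s y * (k y * fderiv ℝ g y v)
  have h2le : (2 : ℕ∞ω) ≤ ∞ := WithTop.coe_le_coe.2 (le_top : (2 : ℕ∞) ≤ ⊤)
  have hkd : ∀ y ∈ U, ContDiffAt ℝ ∞ k y := fun y hy => hk.contDiffAt (hU.mem_nhds hy)
  have hgd : ∀ y ∈ U, ContDiffAt ℝ ∞ g y := fun y hy => hg.contDiffAt (hU.mem_nhds hy)
  have hg1 : ∀ y ∈ U, ContDiffAt ℝ 1 (fderiv ℝ g) y := fun y hy =>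
    (hgd y hy).fderiv_right (m := 1) (by
      rw [one_add_one_eq_two]; exact h2le)
  have hloc : ∀ v, ∀ y ∈ U, V v =ᶠ[𝓝 y] fun z => s y * (k z * fderiv ℝ g z v) := by
    intro v y hy
    filter_upwards [hU.mem_nhds hy, hs y hy] with z hz hsz
    simp only [V, Set.indicator_of_mem hz, hsz]
  have hV0 : ∀ v, ∀ y ∉ K, V v y = 0 := by
    intro v y hy
    by_cases hyU : y ∈ U
    · simp [V, hk0 y hyU hy]
    · simp [V, hyU]
  have hloc0 : ∀ v, ∀ y ∉ K, V v =ᶠ[𝓝 y] fun _ => 0 := by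
    intro v y hy
    filter_upwards [hK.isClosed.isOpen_compl.mem_nhds hy] with z hz
    exact hV0 v z hz
  have hVsmooth : ∀ v, ContDiff ℝ 1 (V v) := by
    intro v
    rw [contDiff_iff_contDiffAt]
    intro y
    by_cases hy : y ∈ U
    · refine ContDiffAt.congr_of_eventuallyEq ?_ (hloc v y hy)
      exact contDiffAt_const.mul (((hkd y hy).of_le (by exact_mod_cast le_top)).mul
        ((hg1 y hy).clm_apply contDiffAt_const))
    · exact contDiffAt_const.congr_of_eventuallyEq (hloc0 v y fun h => hy (hKU h))
  have hVc : ∀ v, HasCompactSupport (V v) := fun v =>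
    HasCompactSupport.intro hK fun y hy => hV0 v y hy
  have hder : ∀ v w, ∀ y ∈ U, fderiv ℝ (V v) y w =
      s y * (k y * fderiv ℝ (fderiv ℝ g) y w v + fderiv ℝ k y w * fderiv ℝ g y v) := by
    intro v w y hy
    rw [(hloc v y hy).fderiv_eq]
    have h1 : HasFDerivAt k (fderiv ℝ k y) y :=
      ((hkd y hy).differentiableAt (by simp)).hasFDerivAt
    have h2 : HasFDerivAt (fderiv ℝ g) (fderiv ℝ (fderiv ℝ g) y) y :=
      ((hg1 y hy).differentiableAt (by simp)).hasFDerivAt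
    have h3 := (h1.mul (h2.clm_apply (hasFDerivAt_const v y))).const_mul (s y)
    have h4 : fderiv ℝ (fun z => s y * (k z * fderiv ℝ g z v)) y = _ := h3.fderiv
    rw [h4]
    simp
    ring
  have hsymm : ∀ y ∈ U, ∀ v w, fderiv ℝ (fderiv ℝ g) y v w = fderiv ℝ (fderiv ℝ g) y w v :=
    fun y hy => ((hgd y hy).isSymmSndFDerivAt (by simpa using h2le)).eq
  have hint : ∀ v w, Integrable fun y => fderiv ℝ (V v) y w := fun v w =>
    (((hVsmooth v).continuous_fderiv one_ne_zero).clm_apply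
      continuous_const).integrable_of_hasCompactSupport ((hVc v).fderiv_apply ℝ w)
  have hfun : U.indicator (fun y => s y * planeJacobian k g y) = fun y =>
      fderiv ℝ (V (stdVec 1)) y (stdVec 0) - fderiv ℝ (V (stdVec 0)) y (stdVec 1) := by
    funext y
    by_cases hy : y ∈ U
    · rw [Set.indicator_of_mem hy, hder _ _ y hy, hder _ _ y hy, hsymm y hy (stdVec 1) (stdVec 0),
        planeJacobian]
      ring
    · have h : y ∉ K := fun h => hy (hKU h)
      rw [Set.indicator_of_notMem hy, (hloc0 _ y h).fderiv_eq, (hloc0 _ y h).fderiv_eq]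
      simp
  rw [← integral_indicator hU.measurableSet, hfun, integral_sub (hint _ _) (hint _ _),
    integral_fderiv_apply_eq_zero (hVsmooth _) (hVc _),
    integral_fderiv_apply_eq_zero (hVsmooth _) (hVc _), sub_zero]

theorem det_eq_stdVec (L : Plane →L[ℝ] Plane) :
    L.det = L (stdVec 0) 0 * L (stdVec 1) 1 - L (stdVec 0) 1 * L (stdVec 1) 0 := by
  rw [ContinuousLinearMap.det,
    ← LinearMap.det_toMatrix (EuclideanSpace.basisFun (Fin 2) ℝ).toBasis, Matrix.det_fin_two]
  simp [LinearMap.toMatrix_apply, stdVec]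
  ring

end PlaneCalculus

/-! ### The area form and the bracket in charts -/

section Charts

variable {M : Type*} [TopologicalSpace M] [ChartedSpace Plane M] [IsManifold (𝓡 2) ∞ M]

theorem mdifferentiableAt_symm {p : M} {y : Plane} (hy : y ∈ (extChartAt (𝓡 2) p).target) :
    MDifferentiableAt 𝓘(ℝ, Plane) (𝓡 2) (extChartAt (𝓡 2) p).symm y :=
  ((contMDiffOn_extChartAt_symm (n := ∞) p).contMDiffAt
    ((isOpen_extChartAt_target p).mem_nhds hy)).mdifferentiableAt (by simp)

theorem contDiffOn_comp_symm {H : M → ℝ} (hH : ContMDiff (𝓡 2) 𝓘(ℝ, ℝ) ∞ H) (p : M) :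
    ContDiffOn ℝ ∞ (H ∘ (extChartAt (𝓡 2) p).symm) (extChartAt (𝓡 2) p).target :=
  contMDiffOn_iff_contDiffOn.1 (hH.comp_contMDiffOn (contMDiffOn_extChartAt_symm p))

theorem fderiv_comp_symm {H : M → ℝ} {p : M} {y : Plane}
    (hy : y ∈ (extChartAt (𝓡 2) p).target)
    (hH : MDifferentiableAt (𝓡 2) 𝓘(ℝ, ℝ) H ((extChartAt (𝓡 2) p).symm y)) (v : Plane) :
    fderiv ℝ (H ∘ (extChartAt (𝓡 2) p).symm) y v =
      mfderiv (𝓡 2) 𝓘(ℝ, ℝ) H ((extChartAt (𝓡 2) p).symm y)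
        (mfderiv 𝓘(ℝ, Plane) (𝓡 2) (extChartAt (𝓡 2) p).symm y v) := by
  rw [← mfderiv_eq_fderiv, mfderiv_comp y hH (mdifferentiableAt_symm hy)]
  rfl

omit [IsManifold (𝓡 2) ∞ M] in
theorem localCoeff_eq (σ : AreaForm M) (p : M) (y : Plane) :
    localCoeff σ.form p y = σ.form ((extChartAt (𝓡 2) p).symm y)
      ![mfderiv 𝓘(ℝ, Plane) (𝓡 2) (extChartAt (𝓡 2) p).symm y (stdVec 0),
        mfderiv 𝓘(ℝ, Plane) (𝓡 2) (extChartAt (𝓡 2) p).symm y (stdVec 1)] := by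
  unfold localCoeff
  congr 1
  ext i : 1
  fin_cases i <;> rfl

/-- The Poisson bracket in a chart. -/
theorem poissonBracket_mul_localCoeff (σ : AreaForm M) {H G : M → ℝ} {p : M} {y : Plane}
    (hy : y ∈ (extChartAt (𝓡 2) p).target)
    (hH : MDifferentiableAt (𝓡 2) 𝓘(ℝ, ℝ) H ((extChartAt (𝓡 2) p).symm y))
    (hG : MDifferentiableAt (𝓡 2) 𝓘(ℝ, ℝ) G ((extChartAt (𝓡 2) p).symm y)) :
    poissonBracket σ H G ((extChartAt (𝓡 2) p).symm y) * localCoeff σ.form p y =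
      -planeJacobian (H ∘ (extChartAt (𝓡 2) p).symm) (G ∘ (extChartAt (𝓡 2) p).symm) y := by
  rw [localCoeff_eq, ← neg_wedgeDiff_eq, planeJacobian, fderiv_comp_symm hy hH,
    fderiv_comp_symm hy hG, fderiv_comp_symm hy hH, fderiv_comp_symm hy hG]
  rfl

/-- The derivative of the inverse chart is invertible, so the coordinate vectors form a basis, and a
2-form on the plane that vanishes on a basis is zero. -/
theorem localCoeff_ne_zero (σ : AreaForm M) {p : M} {y : Plane}
    (hy : y ∈ (extChartAt (𝓡 2) p).target) : localCoeff σ.form p y ≠ 0 := by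
  intro h0
  have hinv : (mfderiv 𝓘(ℝ, Plane) (𝓡 2) (extChartAt (𝓡 2) p).symm y).IsInvertible := by
    have h := isInvertible_mfderivWithin_extChartAt_symm (I := 𝓡 2) hy
    rwa [ModelWithCorners.range_eq_univ, mfderivWithin_univ] at h
  obtain ⟨L, hL⟩ := hinv
  rw [localCoeff_eq, ← hL] at h0
  have key : ∀ (A : Plane [⋀^Fin 2]→L[ℝ] ℝ) (L : Plane ≃L[ℝ] Plane),
      A ![L (stdVec 0), L (stdVec 1)] = 0 → A = 0 := by
    intro A L h
    ext u
    have h1 := form_eq (A.compContinuousLinearMap (L : Plane →L[ℝ] Plane))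
      (L.symm (u 0)) (L.symm (u 1))
    have e : ∀ v w : Plane, (A.compContinuousLinearMap (L : Plane →L[ℝ] Plane)) ![v, w] =
        A ![L v, L w] := by
      intro v w
      show A _ = A _
      congr 1
      ext i : 1
      fin_cases i <;> rfl
    rw [e, e, h, L.apply_symm_apply, L.apply_symm_apply, mul_zero] at h1
    have hu : u = ![u 0, u 1] := by
      ext i : 1
      fin_cases i <;> rfl
    rw [hu, h1]
    rfl
  exact σ.ne_zero _ (key _ L h0)

omit [IsManifold (𝓡 2) ∞ M] in
theorem continuousOn_localCoeff (σ : AreaForm M) (p : M) :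
    ContinuousOn (localCoeff σ.form p) (extChartAt (𝓡 2) p).target :=
  (σ.smooth p).continuousOn

/-- The transition map from the chart at `q` to the chart at `p`. -/
def transition (p q : M) : Plane → Plane := extChartAt (𝓡 2) p ∘ (extChartAt (𝓡 2) q).symm

theorem contDiffAt_transition {p q : M} {y : Plane} (hy : y ∈ (extChartAt (𝓡 2) q).target)
    (hp : (extChartAt (𝓡 2) q).symm y ∈ (extChartAt (𝓡 2) p).source) :
    ContDiffAt ℝ ∞ (transition p q) y := by
  refine contMDiffAt_iff_contDiffAt.1 (ContMDiffAt.comp y (I' := 𝓡 2) ?_ ?_)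
  · exact contMDiffAt_extChartAt' (by rwa [extChartAt_source] at hp)
  · exact (contMDiffOn_extChartAt_symm (n := ∞) q).contMDiffAt ((isOpen_extChartAt_target q).mem_nhds hy)

/-- The transformation rule for the coefficient of a 2-form. -/
theorem localCoeff_transition (σ : AreaForm M) {p q : M} {y : Plane}
    (hy : y ∈ (extChartAt (𝓡 2) q).target)
    (hp : (extChartAt (𝓡 2) q).symm y ∈ (extChartAt (𝓡 2) p).source) :
    localCoeff σ.form q y =
      (fderiv ℝ (transition p q) y).det * localCoeff σ.form p (transition p q y) := by
  have hty : transition p q y ∈ (extChartAt (𝓡 2) p).target :=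
    (extChartAt (𝓡 2) p).map_source hp
  have hsymm : (extChartAt (𝓡 2) p).symm (transition p q y) = (extChartAt (𝓡 2) q).symm y :=
    (extChartAt (𝓡 2) p).left_inv hp
  have heq : (extChartAt (𝓡 2) q).symm =ᶠ[𝓝 y]
      (extChartAt (𝓡 2) p).symm ∘ transition p q := by
    have hc := (mdifferentiableAt_symm hy).continuousAt
    filter_upwards [hc.preimage_mem_nhds ((isOpen_extChartAt_source p).mem_nhds hp)] with z hz
    exact ((extChartAt (𝓡 2) p).left_inv hz).symm
  have hd : MDifferentiableAt 𝓘(ℝ, Plane) 𝓘(ℝ, Plane) (transition p q) y :=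
    ((contDiffAt_transition hy hp).differentiableAt (by simp)).mdifferentiableAt
  have hder : ∀ v : Plane, (mfderiv 𝓘(ℝ, Plane) (𝓡 2) (extChartAt (𝓡 2) q).symm y v : Plane) =
      mfderiv 𝓘(ℝ, Plane) (𝓡 2) (extChartAt (𝓡 2) p).symm (transition p q y)
        (fderiv ℝ (transition p q) y v) := by
    intro v
    rw [heq.mfderiv_eq, mfderiv_comp y (mdifferentiableAt_symm hty) hd, mfderiv_eq_fderiv]
    rfl
  -- Pulling a 2-form on the plane back by `L` multiplies it by `det L`.
  have key : ∀ (A : Plane [⋀^Fin 2]→L[ℝ] ℝ) (D : Plane →L[ℝ] Plane) (L : Plane →L[ℝ] Plane),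
      A ![D (L (stdVec 0)), D (L (stdVec 1))] =
        L.det * A ![D (stdVec 0), D (stdVec 1)] := by
    intro A D L
    have e : ∀ v w : Plane, (A.compContinuousLinearMap D) ![v, w] = A ![D v, D w] := by
      intro v w
      show A _ = A _
      congr 1
      ext i : 1
      fin_cases i <;> rfl
    rw [← e, ← e, form_eq, det_eq_stdVec]
  have hform : (σ.form ((extChartAt (𝓡 2) q).symm y) : Plane [⋀^Fin 2]→L[ℝ] ℝ) =
      σ.form ((extChartAt (𝓡 2) p).symm (transition p q y)) := by rw [hsymm]
  have h1 : localCoeff σ.form q y =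
      (σ.form ((extChartAt (𝓡 2) p).symm (transition p q y)) : Plane [⋀^Fin 2]→L[ℝ] ℝ)
        ![mfderiv 𝓘(ℝ, Plane) (𝓡 2) (extChartAt (𝓡 2) p).symm (transition p q y)
            (fderiv ℝ (transition p q) y (stdVec 0)),
          mfderiv 𝓘(ℝ, Plane) (𝓡 2) (extChartAt (𝓡 2) p).symm (transition p q y)
            (fderiv ℝ (transition p q) y (stdVec 1))] := by
    rw [localCoeff_eq, ← hform, ← hder, ← hder]
    rfl
  rw [h1, localCoeff_eq]
  exact key _ _ _

theorem continuousOn_planeJacobian {U : Set Plane} (hU : IsOpen U) {k g : Plane → ℝ}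
    (hk : ContDiffOn ℝ ∞ k U) (hg : ContDiffOn ℝ ∞ g U) : ContinuousOn (planeJacobian k g) U := by
  have h1 := hk.continuousOn_fderiv_of_isOpen hU (by simp)
  have h2 := hg.continuousOn_fderiv_of_isOpen hU (by simp)
  unfold planeJacobian
  fun_prop

/-- The definition evaluates at `x` on the basis of the preferred chart at `x`, which need not vary
continuously. In one fixed chart the bracket is minus the Jacobian divided by the coefficient of
`σ`. -/
theorem continuous_poissonBracket (σ : AreaForm M) {H G : M → ℝ}
    (hH : ContMDiff (𝓡 2) 𝓘(ℝ, ℝ) ∞ H) (hG : ContMDiff (𝓡 2) 𝓘(ℝ, ℝ) ∞ G) :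
    Continuous (poissonBracket σ H G) := by
  rw [continuous_iff_continuousAt]
  intro p
  let e := extChartAt (𝓡 2) p
  have h1 : ContinuousOn (fun y => -planeJacobian (H ∘ e.symm) (G ∘ e.symm) y /
      localCoeff σ.form p y) e.target :=
    (continuousOn_planeJacobian (isOpen_extChartAt_target p) (contDiffOn_comp_symm hH p)
      (contDiffOn_comp_symm hG p)).neg.div (continuousOn_localCoeff σ p)
      fun y hy => localCoeff_ne_zero σ hy
  have h2 : ContinuousOn ((fun y => -planeJacobian (H ∘ e.symm) (G ∘ e.symm) y /
      localCoeff σ.form p y) ∘ e) e.source :=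
    h1.comp (continuousOn_extChartAt p) fun x hx => e.map_source hx
  refine (h2.continuousAt (extChartAt_source_mem_nhds p)).congr ?_
  filter_upwards [extChartAt_source_mem_nhds (I := 𝓡 2) p] with x hx
  have hy := e.map_source hx
  rw [Function.comp_apply, ← poissonBracket_mul_localCoeff σ hy
    (hH.mdifferentiable (by simp) _) (hG.mdifferentiable (by simp) _),
    mul_div_cancel_right₀ _ (localCoeff_ne_zero σ hy)]
  exact congrArg _ (e.left_inv hx)

end Charts

/-! ### The chart partition of unity as a finite sum -/

section Partition

variable {M : Type*} [TopologicalSpace M] [ChartedSpace Plane M] [IsManifold (𝓡 2) ∞ M]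
  [T2Space M] [CompactSpace M]

variable (M) in
/-- The finitely many indices at which the chart partition does not vanish identically. -/
def partitionIndices : Finset M :=
  ((chartPartition M).locallyFinite.finite_nonempty_of_compact).toFinset

theorem chartPartition_eq_zero {p : M} (hp : p ∉ partitionIndices M) (x : M) :
    chartPartition M p x = 0 := by
  by_contra h
  exact hp ((Set.Finite.mem_toFinset _).2 ⟨x, h⟩)

theorem sum_chartPartition (x : M) : ∑ p ∈ partitionIndices M, chartPartition M p x = 1 := by
  rw [← (chartPartition M).sum_eq_one (Set.mem_univ x)]
  refine (finsum_eq_sum_of_support_subset _ fun p hp => ?_).symm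
  by_contra h
  exact hp (chartPartition_eq_zero h x)

theorem tsupport_chartPartition (p : M) :
    tsupport (chartPartition M p) ⊆ (extChartAt (𝓡 2) p).source :=
  (exists_chartPartition M).choose_spec p

theorem continuous_chartPartition (p : M) : Continuous (chartPartition M p) :=
  (chartPartition M p).contMDiff.continuous

theorem area_nonneg (σ : AreaForm M) : 0 ≤ area σ :=
  finsum_nonneg fun p => integral_nonneg fun _ =>
    mul_nonneg ((chartPartition M).nonneg p _) (abs_nonneg _)

end Partition

/-! ### The measure defined by the area form -/

section ChartMeasure

variable {M : Type*} [TopologicalSpace M] [ChartedSpace Plane M]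
  [MeasurableSpace M] [BorelSpace M]

/-- The measure `|a| dx₁ dx₂` in the coordinates of the chart at `p`. -/
def chartDensity (σ : AreaForm M) (p : M) : Measure Plane :=
  (volume.restrict (extChartAt (𝓡 2) p).target).withDensity
    fun y => ENNReal.ofReal |localCoeff σ.form p y|

/-- The measure `|σ|` on the source of the chart at `p`. -/
def chartMeasure (σ : AreaForm M) (p : M) : Measure M :=
  (chartDensity σ p).map (extChartAt (𝓡 2) p).symm

omit [MeasurableSpace M] [BorelSpace M] in
theorem aemeasurable_localCoeff (σ : AreaForm M) (p : M) :
    AEMeasurable (localCoeff σ.form p) (volume.restrict (extChartAt (𝓡 2) p).target) :=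
  (continuousOn_localCoeff σ p).aemeasurable (isOpen_extChartAt_target p).measurableSet

omit [MeasurableSpace M] [BorelSpace M] in
theorem aemeasurable_density (σ : AreaForm M) (p : M) :
    AEMeasurable (fun y => ENNReal.ofReal |localCoeff σ.form p y|)
      (volume.restrict (extChartAt (𝓡 2) p).target) :=
  (continuous_abs.measurable.comp_aemeasurable (aemeasurable_localCoeff σ p)).ennreal_ofReal

theorem aemeasurable_symm_restrict (p : M) :
    AEMeasurable (extChartAt (𝓡 2) p).symm (volume.restrict (extChartAt (𝓡 2) p).target) :=
  (continuousOn_extChartAt_symm p).aemeasurable (isOpen_extChartAt_target p).measurableSet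

theorem aemeasurable_symm (σ : AreaForm M) (p : M) :
    AEMeasurable (extChartAt (𝓡 2) p).symm (chartDensity σ p) :=
  (aemeasurable_symm_restrict p).mono_ac (withDensity_absolutelyContinuous _ _)

theorem lintegral_chartMeasure (σ : AreaForm M) (p : M) {f : M → ENNReal} (hf : Measurable f) :
    ∫⁻ x, f x ∂chartMeasure σ p = ∫⁻ y in (extChartAt (𝓡 2) p).target,
      ENNReal.ofReal |localCoeff σ.form p y| * f ((extChartAt (𝓡 2) p).symm y) := by
  rw [chartMeasure, lintegral_map' hf.aemeasurable (aemeasurable_symm σ p), chartDensity,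
    lintegral_withDensity_eq_lintegral_mul₀ (aemeasurable_density σ p)
      (g := fun y => f ((extChartAt (𝓡 2) p).symm y))
      (hf.comp_aemeasurable (aemeasurable_symm_restrict p))]
  rfl

theorem integral_chartMeasure (σ : AreaForm M) (p : M) {f : M → ℝ} (hf : Measurable f) :
    ∫ x, f x ∂chartMeasure σ p = ∫ y in (extChartAt (𝓡 2) p).target,
      |localCoeff σ.form p y| * f ((extChartAt (𝓡 2) p).symm y) := by
  rw [chartMeasure, integral_map (aemeasurable_symm σ p) hf.aestronglyMeasurable, chartDensity,
    integral_withDensity_eq_integral_toReal_smul₀ (aemeasurable_density σ p)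
      (Filter.Eventually.of_forall fun _ => ENNReal.ofReal_lt_top)]
  simp [ENNReal.toReal_ofReal]

theorem measurableSet_source (p : M) : MeasurableSet (extChartAt (𝓡 2) p).source :=
  (isOpen_extChartAt_source p).measurableSet

/-- The points of the chart at `p` lying over `S` form the image of `S` under the chart. -/
theorem measurableSet_target_inter_preimage (p : M) {S : Set M} (hS : MeasurableSet S) :
    MeasurableSet ((extChartAt (𝓡 2) p).target ∩ (extChartAt (𝓡 2) p).symm ⁻¹' S) := by
  let e := extChartAt (𝓡 2) p
  have hT : MeasurableSet e.target := (isOpen_extChartAt_target p).measurableSet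
  have hm : Measurable (e.target.domRestrict e.symm) :=
    (continuousOn_iff_continuous_domRestrict.1 (continuousOn_extChartAt_symm p)).measurable
  have h := (MeasurableEmbedding.subtype_coe hT).measurableSet_image.2 (hm hS)
  convert h using 1
  ext y
  constructor
  · rintro ⟨hy, hyS⟩
    exact ⟨⟨y, hy⟩, hyS, rfl⟩
  · rintro ⟨⟨z, hz⟩, hzS, rfl⟩
    exact ⟨hz, hzS⟩

theorem chartMeasure_apply (σ : AreaForm M) (p : M) {S : Set M} (hS : MeasurableSet S) :
    chartMeasure σ p S =
      ∫⁻ y in (extChartAt (𝓡 2) p).target ∩ (extChartAt (𝓡 2) p).symm ⁻¹' S,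
        ENNReal.ofReal |localCoeff σ.form p y| := by
  have h := lintegral_chartMeasure σ p (f := S.indicator 1) (measurable_one.indicator hS)
  rw [lintegral_indicator_one hS] at h
  rw [h, ← lintegral_indicator (measurableSet_target_inter_preimage p hS),
    ← lintegral_indicator (isOpen_extChartAt_target p).measurableSet]
  congr 1
  funext y
  generalize extChartAt (𝓡 2) p = e
  by_cases h1 : y ∈ e.target <;> by_cases h2 : e.symm y ∈ S <;> simp [h1, h2]

variable [IsManifold (𝓡 2) ∞ M]

/-- Change of variables along the transition map: the Jacobian factor is the one in
`localCoeff_transition`. -/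
theorem chartMeasure_inter_source (σ : AreaForm M) (p q : M) {S : Set M} (hS : MeasurableSet S) :
    chartMeasure σ p (S ∩ (extChartAt (𝓡 2) q).source) =
      chartMeasure σ q (S ∩ (extChartAt (𝓡 2) p).source) := by
  rw [chartMeasure_apply σ p (hS.inter (measurableSet_source q)),
    chartMeasure_apply σ q (hS.inter (measurableSet_source p))]
  set A := (extChartAt (𝓡 2) q).target ∩
    (extChartAt (𝓡 2) q).symm ⁻¹' (S ∩ (extChartAt (𝓡 2) p).source) with hA
  have himage : (extChartAt (𝓡 2) p).target ∩
      (extChartAt (𝓡 2) p).symm ⁻¹' (S ∩ (extChartAt (𝓡 2) q).source) = transition p q '' A := by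
    ext z
    constructor
    · rintro ⟨hz, hzS, hzq⟩
      refine ⟨extChartAt (𝓡 2) q ((extChartAt (𝓡 2) p).symm z),
        ⟨(extChartAt (𝓡 2) q).map_source hzq, ?_, ?_⟩, ?_⟩
      · rwa [(extChartAt (𝓡 2) q).left_inv hzq]
      · rw [(extChartAt (𝓡 2) q).left_inv hzq]
        exact (extChartAt (𝓡 2) p).map_target hz
      · rw [transition, Function.comp_apply, (extChartAt (𝓡 2) q).left_inv hzq,
          (extChartAt (𝓡 2) p).right_inv hz]
    · rintro ⟨y, ⟨hy, hyS, hyp⟩, rfl⟩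
      refine ⟨(extChartAt (𝓡 2) p).map_source hyp, ?_, ?_⟩
      · rw [transition, Function.comp_apply, (extChartAt (𝓡 2) p).left_inv hyp]
        exact hyS
      · rw [transition, Function.comp_apply, (extChartAt (𝓡 2) p).left_inv hyp]
        exact (extChartAt (𝓡 2) q).map_target hy
  have hAm : MeasurableSet A :=
    measurableSet_target_inter_preimage q (hS.inter (measurableSet_source p))
  have hinj : Set.InjOn (transition p q) A := by
    rintro y ⟨hy, -, hyp⟩ z ⟨hz, -, hzp⟩ h
    exact (extChartAt (𝓡 2) q).symm.injOn hy hz ((extChartAt (𝓡 2) p).injOn hyp hzp h)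
  have hder : ∀ y ∈ A, HasFDerivWithinAt (transition p q) (fderiv ℝ (transition p q) y) A y := by
    rintro y ⟨hy, -, hyp⟩
    exact ((contDiffAt_transition hy hyp).differentiableAt
      (by simp)).hasFDerivAt.hasFDerivWithinAt
  rw [himage, lintegral_image_eq_lintegral_abs_det_fderiv_mul volume hAm hder hinj]
  refine setLIntegral_congr_fun hAm ?_
  rintro y ⟨hy, -, hyp⟩
  simp only
  rw [localCoeff_transition σ hy hyp, abs_mul, ENNReal.ofReal_mul (abs_nonneg _)]

theorem chartMeasure_restrict_source (σ : AreaForm M) (p q : M) :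
    (chartMeasure σ p).restrict (extChartAt (𝓡 2) q).source =
      (chartMeasure σ q).restrict (extChartAt (𝓡 2) p).source := by
  ext S hS
  rw [Measure.restrict_apply hS, Measure.restrict_apply hS, chartMeasure_inter_source σ p q hS]

variable [T2Space M] [CompactSpace M]

/-- The measure on `M` defined by the area form. -/
def areaMeasure (σ : AreaForm M) : Measure M :=
  ∑ p ∈ partitionIndices M,
    (chartMeasure σ p).withDensity fun x => ENNReal.ofReal (chartPartition M p x)

theorem measurable_ofReal_chartPartition (p : M) :
    Measurable fun x => ENNReal.ofReal (chartPartition M p x) :=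
  (continuous_chartPartition p).measurable.ennreal_ofReal

/-- The chart measures agree on overlaps and the weights sum to 1. Hence the partition of unity
drops out, and integrals over a chart need no weights. -/
theorem areaMeasure_restrict_source (σ : AreaForm M) (q : M) :
    (areaMeasure σ).restrict (extChartAt (𝓡 2) q).source = chartMeasure σ q := by
  ext S hS
  have hterm : ∀ p : M, ((chartMeasure σ p).withDensity
      fun x => ENNReal.ofReal (chartPartition M p x)) (S ∩ (extChartAt (𝓡 2) q).source) =
      ∫⁻ x in S, ENNReal.ofReal (chartPartition M p x) ∂chartMeasure σ q := by
    intro p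
    rw [withDensity_apply _ (hS.inter (measurableSet_source q)),
      ← Measure.restrict_restrict hS, chartMeasure_restrict_source,
      Measure.restrict_restrict hS, ← lintegral_indicator hS,
      ← lintegral_indicator (hS.inter (measurableSet_source p))]
    congr 1
    funext x
    by_cases h1 : x ∈ S <;> by_cases h2 : x ∈ (extChartAt (𝓡 2) p).source
    · rw [Set.indicator_of_mem (Set.mem_inter h1 h2), Set.indicator_of_mem h1]
    · have : chartPartition M p x = 0 :=
        image_eq_zero_of_notMem_tsupport fun h => h2 (tsupport_chartPartition p h)
      simp [h1, this]
    · simp [h1]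
    · simp [h1]
  rw [Measure.restrict_apply hS, areaMeasure, Measure.finsetSum_apply,
    Finset.sum_congr rfl fun p _ => hterm p,
    ← lintegral_finsetSum _ fun p _ => measurable_ofReal_chartPartition p]
  simp_rw [← ENNReal.ofReal_sum_of_nonneg fun p _ => (chartPartition M).nonneg p _,
    sum_chartPartition]
  simp

omit [MeasurableSpace M] [BorelSpace M] in
-- The whole chart may have infinite coordinate area, but the integrand vanishes off a compact set.
-- Integrability ensures that the integrals in `area` are not the default value 0.
theorem integrableOn_chartPartition_mul (σ : AreaForm M) (p : M) :
    IntegrableOn (fun y => chartPartition M p ((extChartAt (𝓡 2) p).symm y) *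
      |localCoeff σ.form p y|) (extChartAt (𝓡 2) p).target := by
  let e := extChartAt (𝓡 2) p
  let K := e '' tsupport (chartPartition M p)
  have hK : IsCompact K := (isClosed_tsupport _).isCompact.image_of_continuousOn
    ((continuousOn_extChartAt p).mono (tsupport_chartPartition p))
  have hKT : K ⊆ e.target := by
    rintro _ ⟨x, hx, rfl⟩
    exact e.map_source (tsupport_chartPartition p hx)
  have hc : ContinuousOn (fun y => chartPartition M p (e.symm y) * |localCoeff σ.form p y|)
      e.target :=
    ((continuous_chartPartition p).comp_continuousOn (continuousOn_extChartAt_symm p)).mul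
      (continuousOn_localCoeff σ p).abs
  refine IntegrableOn.of_forall_sdiff_eq_zero ((hc.mono hKT).integrableOn_compact hK)
    (isOpen_extChartAt_target p).measurableSet ?_
  rintro y ⟨hy, hyK⟩
  have : chartPartition M p (e.symm y) = 0 :=
    image_eq_zero_of_notMem_tsupport fun h => hyK ⟨_, h, e.right_inv hy⟩
  simp only [e] at this
  rw [this, zero_mul]

theorem areaMeasure_univ (σ : AreaForm M) :
    areaMeasure σ Set.univ = ENNReal.ofReal (area σ) := by
  have hnn : ∀ (p : M) (y : Plane), 0 ≤ chartPartition M p ((extChartAt (𝓡 2) p).symm y) *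
      |localCoeff σ.form p y| := fun p y =>
    mul_nonneg ((chartPartition M).nonneg p _) (abs_nonneg _)
  have h1 : area σ = ∑ p ∈ partitionIndices M, ∫ y in (extChartAt (𝓡 2) p).target,
      chartPartition M p ((extChartAt (𝓡 2) p).symm y) * |localCoeff σ.form p y| := by
    refine finsum_eq_sum_of_support_subset _ fun p hp => ?_
    by_contra h
    exact hp (by simp [chartPartition_eq_zero h])
  rw [h1, ENNReal.ofReal_sum_of_nonneg fun p _ => integral_nonneg (hnn p), areaMeasure,
    Measure.finsetSum_apply]
  refine Finset.sum_congr rfl fun p _ => ?_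
  rw [withDensity_apply _ MeasurableSet.univ, Measure.restrict_univ,
    lintegral_chartMeasure σ p (measurable_ofReal_chartPartition p),
    ofReal_integral_eq_lintegral_ofReal (integrableOn_chartPartition_mul σ p)
      (Filter.Eventually.of_forall (hnn p))]
  refine lintegral_congr fun y => ?_
  rw [← ENNReal.ofReal_mul (abs_nonneg _), mul_comm]

instance isFiniteMeasure_areaMeasure (σ : AreaForm M) : IsFiniteMeasure (areaMeasure σ) :=
  ⟨by rw [areaMeasure_univ]; exact ENNReal.ofReal_lt_top⟩

end ChartMeasure

/-! ### Algebraic rules for the Poisson bracket -/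

section Bracket

variable {M : Type*} [TopologicalSpace M] [ChartedSpace Plane M]

theorem poissonBracket_swap (σ : AreaForm M) (F G : M → ℝ) (x : M) :
    poissonBracket σ F G x = -poissonBracket σ G F x := by
  unfold poissonBracket wedgeDiff
  ring

theorem poissonBracket_neg_neg (σ : AreaForm M) (F G : M → ℝ) (x : M) :
    poissonBracket σ (-F) (-G) x = poissonBracket σ F G x := by
  unfold poissonBracket wedgeDiff
  rw [mfderiv_neg, mfderiv_neg]
  congr 2
  exact congrArg₂ (· - ·) (neg_mul_neg _ _) (neg_mul_neg _ _)

theorem poissonBracket_eq_zero_of_eventuallyEq (σ : AreaForm M) {F G : M → ℝ} {x : M}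
    (h : F =ᶠ[𝓝 x] fun _ => 0) : poissonBracket σ F G x = 0 := by
  have h0 : mfderiv (𝓡 2) 𝓘(ℝ, ℝ) F x = 0 := by
    rw [h.mfderiv_eq]
    exact mfderiv_const
  have key : ∀ (β : Plane →L[ℝ] ℝ) (c : ℝ), -((0 : Plane →L[ℝ] ℝ) (stdVec 0) * β (stdVec 1) -
      (0 : Plane →L[ℝ] ℝ) (stdVec 1) * β (stdVec 0)) / c = 0 := by
    intro β c
    simp
  unfold poissonBracket wedgeDiff
  rw [h0]
  exact key _ _

theorem poissonBracket_add (σ : AreaForm M) {F H G : M → ℝ} {x : M}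
    (hF : MDifferentiableAt (𝓡 2) 𝓘(ℝ, ℝ) F x) (hH : MDifferentiableAt (𝓡 2) 𝓘(ℝ, ℝ) H x) :
    poissonBracket σ (F + H) G x = poissonBracket σ F G x + poissonBracket σ H G x := by
  have key : ∀ (α α' β : Plane →L[ℝ] ℝ) (c : ℝ),
      -((α + α') (stdVec 0) * β (stdVec 1) - (α + α') (stdVec 1) * β (stdVec 0)) / c =
      -(α (stdVec 0) * β (stdVec 1) - α (stdVec 1) * β (stdVec 0)) / c +
      -(α' (stdVec 0) * β (stdVec 1) - α' (stdVec 1) * β (stdVec 0)) / c := by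
    intro α α' β c
    simp only [add_apply]
    ring
  unfold poissonBracket wedgeDiff
  rw [mfderiv_add hF hH]
  exact key _ _ _ _

theorem poissonBracket_sum (σ : AreaForm M) {ι : Type*} (t : Finset ι) {f : ι → M → ℝ}
    {G : M → ℝ} (hf : ∀ i, ContMDiff (𝓡 2) 𝓘(ℝ, ℝ) ∞ (f i)) (x : M) :
    poissonBracket σ (∑ i ∈ t, f i) G x = ∑ i ∈ t, poissonBracket σ (f i) G x := by
  classical
  have hd : ∀ s : Finset ι, ContMDiff (𝓡 2) 𝓘(ℝ, ℝ) ∞ (∑ i ∈ s, f i) := by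
    intro s
    convert contMDiff_finsetSum (t := s) (f := f) fun i _ => hf i using 1
    ext x
    simp
  induction t using Finset.induction_on with
  | empty =>
    rw [Finset.sum_empty, Finset.sum_empty]
    exact poissonBracket_eq_zero_of_eventuallyEq σ (Filter.Eventually.of_forall fun _ => rfl)
  | insert a s ha ih =>
    rw [Finset.sum_insert ha, Finset.sum_insert ha,
      poissonBracket_add σ ((hf a).mdifferentiable (by simp) x)
        ((hd s).mdifferentiable (by simp) x), ih]

/-- The bracket of a function of `s F + t G` with `G`. -/
theorem poissonBracket_comp_left (σ : AreaForm M) {F G : M → ℝ}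
    (hF : ContMDiff (𝓡 2) 𝓘(ℝ, ℝ) ∞ F) (hG : ContMDiff (𝓡 2) 𝓘(ℝ, ℝ) ∞ G) {φ : ℝ → ℝ}
    (hφ : Differentiable ℝ φ) (s t : ℝ) (x : M) :
    poissonBracket σ (fun x => φ (s * F x + t * G x)) G x =
      s * (deriv φ (s * F x + t * G x) * poissonBracket σ F G x) := by
  have h1 := (hF.mdifferentiable (by simp) x).hasMFDerivAt
  have h2 := (hG.mdifferentiable (by simp) x).hasMFDerivAt
  have h3 := (h1.const_smul s).add (h2.const_smul t)
  have h4 : HasMFDerivAt 𝓘(ℝ, ℝ) 𝓘(ℝ, ℝ) φ ((s • F + t • G) x) _ :=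
    (hφ _).hasFDerivAt.hasMFDerivAt
  have h5 := (h4.comp x h3).mfderiv
  have h6 : (φ ∘ (s • F + t • G)) = fun x => φ (s * F x + t * G x) := rfl
  rw [h6] at h5
  have key : ∀ (α β : Plane →L[ℝ] ℝ) (L : ℝ →L[ℝ] ℝ) (c : ℝ),
      -((L ∘L (s • α + t • β)) (stdVec 0) * β (stdVec 1) -
        (L ∘L (s • α + t • β)) (stdVec 1) * β (stdVec 0)) / c =
      s * (L 1 * (-(α (stdVec 0) * β (stdVec 1) - α (stdVec 1) * β (stdVec 0)) / c)) := by
    intro α β L c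
    have hL : ∀ r : ℝ, L r = r * L 1 := fun r => by
      rw [← smul_eq_mul, ← map_smul, smul_eq_mul, mul_one]
    simp only [ContinuousLinearMap.comp_apply, add_apply, smul_apply, smul_eq_mul]
    rw [hL (_ + _), hL (_ + _)]
    ring
  unfold poissonBracket wedgeDiff
  rw [h5]
  exact key _ _ _ _

end Bracket

/-! ### Stokes' theorem on the surface -/

section Stokes

variable {M : Type*} [TopologicalSpace M] [ChartedSpace Plane M] [IsManifold (𝓡 2) ∞ M]
  [T2Space M] [CompactSpace M] [MeasurableSpace M] [BorelSpace M]

theorem integrable_of_continuous (σ : AreaForm M) {E : Type*} [NormedAddCommGroup E]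
    [SecondCountableTopology E] {f : M → E} (hf : Continuous f) :
    Integrable f (areaMeasure σ) := by
  borelize E
  obtain ⟨C, hC⟩ := isCompact_univ.exists_bound_of_continuousOn hf.continuousOn
  exact Integrable.of_bound hf.measurable.aestronglyMeasurable C
    (Filter.Eventually.of_forall fun x => hC x (Set.mem_univ x))

/-- In the chart, `{K, G} |a|` is the Jacobian of `(K, G)` times `-|a| / a`, so the planar Stokes
theorem applies. -/
theorem integral_poissonBracket_eq_zero_of_tsupport (σ : AreaForm M) {K G : M → ℝ}
    (hK : ContMDiff (𝓡 2) 𝓘(ℝ, ℝ) ∞ K) (hG : ContMDiff (𝓡 2) 𝓘(ℝ, ℝ) ∞ G) {p : M}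
    (hp : tsupport K ⊆ (extChartAt (𝓡 2) p).source) :
    ∫ x, poissonBracket σ K G x ∂areaMeasure σ = 0 := by
  let e := extChartAt (𝓡 2) p
  have hoff : ∀ x ∉ e.source, poissonBracket σ K G x = 0 := fun x hx =>
    poissonBracket_eq_zero_of_eventuallyEq σ
      (notMem_tsupport_iff_eventuallyEq.1 fun h => hx (hp h))
  rw [← setIntegral_eq_integral_of_forall_compl_eq_zero hoff, areaMeasure_restrict_source,
    integral_chartMeasure σ p (continuous_poissonBracket σ hK hG).measurable]
  let a := localCoeff σ.form p
  have hcompact : IsCompact (e '' tsupport K) :=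
    (isClosed_tsupport _).isCompact.image_of_continuousOn ((continuousOn_extChartAt p).mono hp)
  have hsub : e '' tsupport K ⊆ e.target := by
    rintro _ ⟨x, hx, rfl⟩
    exact e.map_source (hp hx)
  have hzero : ∀ y ∈ e.target, y ∉ e '' tsupport K → (K ∘ e.symm) y = 0 := fun y hy hyK =>
    image_eq_zero_of_notMem_tsupport (f := K) fun h => hyK ⟨_, h, e.right_inv hy⟩
  -- The sign of `a` is only locally constant, since the chart domain may be disconnected.
  have hs : ∀ y ∈ e.target, ∀ᶠ z in 𝓝 y, -(|a z| / a z) = -(|a y| / a y) := by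
    intro y hy
    have hc : ContinuousAt a y :=
      (continuousOn_localCoeff σ p).continuousAt ((isOpen_extChartAt_target p).mem_nhds hy)
    rcases lt_or_gt_of_ne (localCoeff_ne_zero σ hy) with h | h
    · have hay : a y < 0 := h
      filter_upwards [hc.eventually_lt_const hay] with z hz
      rw [abs_of_neg hz, abs_of_neg hay, neg_div, neg_div, div_self hz.ne, div_self hay.ne]
    · have hay : 0 < a y := h
      filter_upwards [hc.eventually_const_lt hay] with z hz
      rw [abs_of_pos hz, abs_of_pos hay, div_self hz.ne', div_self hay.ne']
  rw [← setIntegral_planeJacobian_eq_zero (isOpen_extChartAt_target p) hcompact hsub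
    (contDiffOn_comp_symm hK p) (contDiffOn_comp_symm hG p) hzero hs]
  refine setIntegral_congr_fun (isOpen_extChartAt_target p).measurableSet fun y hy => ?_
  have h1 := poissonBracket_mul_localCoeff σ hy (hK.mdifferentiable (by simp) _)
    (hG.mdifferentiable (by simp) _)
  have hne : a y ≠ 0 := localCoeff_ne_zero σ hy
  have h2 : planeJacobian (K ∘ e.symm) (G ∘ e.symm) y =
      -(poissonBracket σ K G (e.symm y) * a y) := by rw [h1, neg_neg]
  change |a y| * poissonBracket σ K G (e.symm y) =
    -(|a y| / a y) * planeJacobian (K ∘ e.symm) (G ∘ e.symm) y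
  rw [h2, neg_mul_neg, mul_comm _ (a y), ← mul_assoc, div_mul_cancel₀ _ hne]

/-- The Poisson bracket of two smooth functions has zero mean. -/
theorem integral_poissonBracket (σ : AreaForm M) {H G : M → ℝ}
    (hH : ContMDiff (𝓡 2) 𝓘(ℝ, ℝ) ∞ H) (hG : ContMDiff (𝓡 2) 𝓘(ℝ, ℝ) ∞ G) :
    ∫ x, poissonBracket σ H G x ∂areaMeasure σ = 0 := by
  let f : M → M → ℝ := fun p x => chartPartition M p x * H x
  have hf : ∀ p, ContMDiff (𝓡 2) 𝓘(ℝ, ℝ) ∞ (f p) := fun p =>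
    (chartPartition M p).contMDiff.mul hH
  have hsum : H = ∑ p ∈ partitionIndices M, f p := by
    ext x
    rw [Finset.sum_apply, ← Finset.sum_mul, sum_chartPartition, one_mul]
  have h1 : ∀ x, poissonBracket σ H G x =
      ∑ p ∈ partitionIndices M, poissonBracket σ (f p) G x := by
    intro x
    conv_lhs => rw [hsum]
    exact poissonBracket_sum σ _ hf x
  simp_rw [h1]
  rw [integral_finsetSum _ fun p _ =>
    integrable_of_continuous σ (continuous_poissonBracket σ (hf p) hG)]
  refine Finset.sum_eq_zero fun p _ =>
    integral_poissonBracket_eq_zero_of_tsupport σ (hf p) hG (p := p) ?_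
  exact (tsupport_mul_subset_left).trans (tsupport_chartPartition p)

/-- For `s ≠ 0` the integrand is `s⁻¹ {φ(sF + tG), G}`, which has zero mean; for `t ≠ 0` the roles
of `F` and `G` are exchanged. The case of trigonometric `φ` gives the Fourier coefficients below. -/
theorem integral_deriv_mul_poissonBracket (σ : AreaForm M) {F G : M → ℝ}
    (hF : ContMDiff (𝓡 2) 𝓘(ℝ, ℝ) ∞ F) (hG : ContMDiff (𝓡 2) 𝓘(ℝ, ℝ) ∞ G) {φ : ℝ → ℝ}
    (hφ : ContDiff ℝ ∞ φ) {s t : ℝ} (hst : s ≠ 0 ∨ t ≠ 0) :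
    ∫ x, deriv φ (s * F x + t * G x) * poissonBracket σ F G x ∂areaMeasure σ = 0 := by
  have hsmooth : ∀ (F G : M → ℝ), ContMDiff (𝓡 2) 𝓘(ℝ, ℝ) ∞ F → ContMDiff (𝓡 2) 𝓘(ℝ, ℝ) ∞ G →
      ∀ s t : ℝ, ContMDiff (𝓡 2) 𝓘(ℝ, ℝ) ∞ fun x => φ (s * F x + t * G x) := fun F G hF hG s t =>
    hφ.contMDiff.comp ((contMDiff_const.mul hF).add (contMDiff_const.mul hG))
  have main : ∀ (F G : M → ℝ), ContMDiff (𝓡 2) 𝓘(ℝ, ℝ) ∞ F → ContMDiff (𝓡 2) 𝓘(ℝ, ℝ) ∞ G →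
      ∀ s t : ℝ, s ≠ 0 →
      ∫ x, deriv φ (s * F x + t * G x) * poissonBracket σ F G x ∂areaMeasure σ = 0 := by
    intro F G hF hG s t hs
    have h := integral_poissonBracket σ (hsmooth F G hF hG s t) hG
    simp_rw [poissonBracket_comp_left σ hF hG (hφ.differentiable (by simp)) s t] at h
    rw [integral_const_mul] at h
    exact (mul_eq_zero.1 h).resolve_left hs
  rcases hst with hs | ht
  · exact main F G hF hG s t hs
  · have h := main G F hG hF t s ht
    rw [← neg_eq_zero, ← integral_neg, ← h]
    refine integral_congr_ae (Filter.Eventually.of_forall fun x => ?_)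
    simp only
    rw [poissonBracket_swap σ F G, add_comm (t * G x)]
    ring

end Stokes

/-! ### The area formula and degree zero -/

section AreaFormula

variable {M : Type*} [TopologicalSpace M] [ChartedSpace Plane M] [IsManifold (𝓡 2) ∞ M]
  [T2Space M] [CompactSpace M] [MeasurableSpace M] [BorelSpace M]

/-- The map `(F, G)` to the plane. -/
def pairMap (F G : M → ℝ) (x : M) : Plane := !₂[F x, G x]

omit [ChartedSpace Plane M] [IsManifold (𝓡 2) ∞ M] [T2Space M] [CompactSpace M]
  [MeasurableSpace M] [BorelSpace M] in
theorem continuous_pairMap {F G : M → ℝ} (hF : Continuous F) (hG : Continuous G) :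
    Continuous (pairMap F G) := by
  unfold pairMap
  fun_prop

theorem setLIntegral_areaMeasure (σ : AreaForm M) {p : M} {S : Set M} (hS : MeasurableSet S)
    (hSp : S ⊆ (extChartAt (𝓡 2) p).source) {f : M → ENNReal} (hf : Measurable f) :
    ∫⁻ x in S, f x ∂areaMeasure σ =
      ∫⁻ y in (extChartAt (𝓡 2) p).target ∩ (extChartAt (𝓡 2) p).symm ⁻¹' S,
        ENNReal.ofReal |localCoeff σ.form p y| * f ((extChartAt (𝓡 2) p).symm y) := by
  rw [← Set.inter_eq_self_of_subset_left hSp, ← Measure.restrict_restrict hS,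
    areaMeasure_restrict_source, Set.inter_eq_self_of_subset_left hSp, ← lintegral_indicator hS,
    lintegral_chartMeasure σ p (hf.indicator hS),
    ← lintegral_indicator (measurableSet_target_inter_preimage p hS),
    ← lintegral_indicator (isOpen_extChartAt_target p).measurableSet]
  congr 1
  funext y
  generalize extChartAt (𝓡 2) p = e
  by_cases h1 : y ∈ e.target <;> by_cases h2 : e.symm y ∈ S <;> simp [h1, h2]

omit [T2Space M] [CompactSpace M] [MeasurableSpace M] [BorelSpace M] in
theorem hasFDerivAt_pairMap_comp_symm {F G : M → ℝ} (hF : ContMDiff (𝓡 2) 𝓘(ℝ, ℝ) ∞ F)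
    (hG : ContMDiff (𝓡 2) 𝓘(ℝ, ℝ) ∞ G) {p : M} {y : Plane}
    (hy : y ∈ (extChartAt (𝓡 2) p).target) :
    ∃ L : Plane →L[ℝ] Plane, HasFDerivAt (pairMap F G ∘ (extChartAt (𝓡 2) p).symm) L y ∧
      L.det = planeJacobian (F ∘ (extChartAt (𝓡 2) p).symm)
        (G ∘ (extChartAt (𝓡 2) p).symm) y := by
  let e := extChartAt (𝓡 2) p
  have hF' : DifferentiableAt ℝ (F ∘ e.symm) y :=
    ((contDiffOn_comp_symm hF p).contDiffAt
      ((isOpen_extChartAt_target p).mem_nhds hy)).differentiableAt (by simp)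
  have hG' : DifferentiableAt ℝ (G ∘ e.symm) y :=
    ((contDiffOn_comp_symm hG p).contDiffAt
      ((isOpen_extChartAt_target p).mem_nhds hy)).differentiableAt (by simp)
  have hd : DifferentiableAt ℝ (pairMap F G ∘ e.symm) y := by
    rw [differentiableAt_euclidean]
    intro i
    fin_cases i
    · exact hF'
    · exact hG'
  refine ⟨fderiv ℝ (pairMap F G ∘ e.symm) y, hd.hasFDerivAt, ?_⟩
  have hcoord : ∀ (i : Fin 2) (v : Plane), fderiv ℝ (pairMap F G ∘ e.symm) y v i =
      fderiv ℝ (fun z => (pairMap F G ∘ e.symm) z i) y v := by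
    intro i v
    have h := ((EuclideanSpace.proj i : Plane →L[ℝ] ℝ).hasFDerivAt
      (x := (pairMap F G ∘ e.symm) y)).comp y hd.hasFDerivAt
    have h' : fderiv ℝ (fun z => (pairMap F G ∘ e.symm) z i) y = _ := h.fderiv
    rw [h']
    rfl
  have h0 : (fun z => (pairMap F G ∘ e.symm) z 0) = F ∘ e.symm := rfl
  have h1 : (fun z => (pairMap F G ∘ e.symm) z 1) = G ∘ e.symm := rfl
  rw [det_eq_stdVec, hcoord, hcoord, hcoord, hcoord, h0, h1, planeJacobian]
  ring

/-- The image of a measurable set under `(F, G)` has measure at most `∫ |{F, G}|`. -/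
theorem volume_image_pairMap_le (σ : AreaForm M) {F G : M → ℝ}
    (hF : ContMDiff (𝓡 2) 𝓘(ℝ, ℝ) ∞ F) (hG : ContMDiff (𝓡 2) 𝓘(ℝ, ℝ) ∞ G) {S : Set M}
    (hS : MeasurableSet S) :
    volume (pairMap F G '' S) ≤
      ∫⁻ x in S, ENNReal.ofReal |poissonBracket σ F G x| ∂areaMeasure σ := by
  classical
  have hm : Measurable fun x => ENNReal.ofReal |poissonBracket σ F G x| :=
    (continuous_poissonBracket σ hF hG).abs.measurable.ennreal_ofReal
  have hchart : ∀ (p : M) (S : Set M), MeasurableSet S → S ⊆ (extChartAt (𝓡 2) p).source →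
      volume (pairMap F G '' S) ≤
        ∫⁻ x in S, ENNReal.ofReal |poissonBracket σ F G x| ∂areaMeasure σ := by
    intro p S hS hSp
    let e := extChartAt (𝓡 2) p
    have himage : pairMap F G '' S = (pairMap F G ∘ e.symm) '' (e.target ∩ e.symm ⁻¹' S) := by
      rw [Set.image_comp]
      congr 1
      ext x
      constructor
      · intro hx
        exact ⟨e x, ⟨e.map_source (hSp hx), by rwa [Set.mem_preimage, e.left_inv (hSp hx)]⟩,
          e.left_inv (hSp hx)⟩
      · rintro ⟨y, ⟨-, hy⟩, rfl⟩
        exact hy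
    have hA := measurableSet_target_inter_preimage p hS
    choose! L hL hdet using fun (y : Plane) (hy : y ∈ e.target) =>
      hasFDerivAt_pairMap_comp_symm hF hG hy
    rw [himage, setLIntegral_areaMeasure σ hS hSp hm]
    refine (addHaar_image_le_lintegral_abs_det_fderiv volume hA
      fun y hy => (hL y hy.1).hasFDerivWithinAt).trans_eq ?_
    refine setLIntegral_congr_fun hA fun y hy => ?_
    rw [hdet y hy.1, ← ENNReal.ofReal_mul (abs_nonneg _), mul_comm, ← abs_mul,
      poissonBracket_mul_localCoeff σ hy.1 (hF.mdifferentiable (by simp) _)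
        (hG.mdifferentiable (by simp) _), abs_neg]
  -- Chart by chart: the part of `S` inside one chart is split off, so that the integrals add up
  -- without overlap.
  have hfin : ∀ (t : Finset M) (S : Set M), MeasurableSet S →
      S ⊆ ⋃ p ∈ t, (extChartAt (𝓡 2) p).source →
      volume (pairMap F G '' S) ≤
        ∫⁻ x in S, ENNReal.ofReal |poissonBracket σ F G x| ∂areaMeasure σ := by
    intro t
    induction t using Finset.induction_on with
    | empty =>
      intro S _ hSt
      have : S = ∅ := by simpa using hSt
      simp [this]
    | insert a t _ ih =>
      intro S hS hSt
      have ha := measurableSet_source a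
      have h1 := hchart a (S ∩ (extChartAt (𝓡 2) a).source) (hS.inter ha) Set.inter_subset_right
      have h2 := ih (S \ (extChartAt (𝓡 2) a).source) (hS.diff ha) (by
        rintro x ⟨hx, hxa⟩
        have := hSt hx
        rw [Finset.set_biUnion_insert] at this
        exact this.resolve_left hxa)
      calc volume (pairMap F G '' S)
          ≤ volume (pairMap F G '' (S ∩ (extChartAt (𝓡 2) a).source)) +
            volume (pairMap F G '' (S \ (extChartAt (𝓡 2) a).source)) := by
            refine le_trans (measure_mono ?_) (measure_union_le _ _)
            rw [← Set.image_union, Set.inter_union_sdiff]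
        _ ≤ _ := add_le_add h1 h2
        _ = _ := lintegral_inter_add_sdiff _ _ ha
  refine hfin (partitionIndices M) S hS fun x _ => ?_
  obtain ⟨p, hp, hpx⟩ : ∃ p ∈ partitionIndices M, chartPartition M p x ≠ 0 :=
    Finset.exists_ne_zero_of_sum_ne_zero (by rw [sum_chartPartition]; exact one_ne_zero)
  exact Set.mem_biUnion hp (tsupport_chartPartition p (subset_tsupport _ hpx))

/-- This is the Fourier transform at `(s, t)` of the image of the signed measure `{F, G} |σ|` under
`(F, G)`. Off the origin, cosine and sine are derivatives; at the origin it is the mean of the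
bracket. -/
theorem integral_cexp_mul_poissonBracket (σ : AreaForm M) {F G : M → ℝ}
    (hF : ContMDiff (𝓡 2) 𝓘(ℝ, ℝ) ∞ F) (hG : ContMDiff (𝓡 2) 𝓘(ℝ, ℝ) ∞ G) (s t : ℝ) :
    ∫ x, (poissonBracket σ F G x : ℂ) *
      Complex.exp ((s * F x + t * G x : ℝ) * Complex.I) ∂areaMeasure σ = 0 := by
  have hJ := continuous_poissonBracket σ hF hG
  have hFc := hF.continuous
  have hGc := hG.continuous
  by_cases hst : s ≠ 0 ∨ t ≠ 0
  · have h1 := integral_deriv_mul_poissonBracket σ hF hG Real.contDiff_sin hst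
    have h2 := integral_deriv_mul_poissonBracket σ hF hG Real.contDiff_cos hst
    have e : ∀ x, (poissonBracket σ F G x : ℂ) *
        Complex.exp ((s * F x + t * G x : ℝ) * Complex.I) =
        ((deriv Real.sin (s * F x + t * G x) * poissonBracket σ F G x : ℝ) : ℂ) -
        ((deriv Real.cos (s * F x + t * G x) * poissonBracket σ F G x : ℝ) : ℂ) * Complex.I := by
      intro x
      rw [Complex.exp_mul_I, Real.deriv_sin, Real.deriv_cos]
      push_cast
      ring
    simp_rw [e]
    rw [integral_sub, integral_mul_const, integral_complex_ofReal, integral_complex_ofReal, h1, h2]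
    · simp
    · refine integrable_of_continuous σ ?_
      simp only [Real.deriv_sin]
      fun_prop
    · refine integrable_of_continuous σ ?_
      simp only [Real.deriv_cos']
      fun_prop
  · push Not at hst
    have h := integral_poissonBracket σ hF hG
    simp [hst.1, hst.2, integral_complex_ofReal, h]

/-- The image under `(F, G)` of the part of `|σ|` weighted by the positive part of a function. -/
def positivePush (σ : AreaForm M) (F G J : M → ℝ) : Measure Plane :=
  ((areaMeasure σ).withDensity fun x => ENNReal.ofReal (J x)).map (pairMap F G)

theorem charFun_positivePush (σ : AreaForm M) {F G J : M → ℝ} (hF : Continuous F)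
    (hG : Continuous G) (hJ : Continuous J) (t : Plane) :
    charFun (positivePush σ F G J) t = ∫ x, ((max (J x) 0 : ℝ) : ℂ) *
      Complex.exp ((t 0 * F x + t 1 * G x : ℝ) * Complex.I) ∂areaMeasure σ := by
  rw [charFun_apply, positivePush,
    integral_map (continuous_pairMap hF hG).measurable.aemeasurable (by
      exact Continuous.aestronglyMeasurable (by fun_prop)),
    integral_withDensity_eq_integral_toReal_smul hJ.measurable.ennreal_ofReal
      (Filter.Eventually.of_forall fun _ => ENNReal.ofReal_lt_top)]
  refine integral_congr_ae (Filter.Eventually.of_forall fun x => ?_)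
  simp [pairMap, PiLp.inner_apply, Fin.sum_univ_two, ENNReal.toReal_ofReal']

theorem isFiniteMeasure_positivePush (σ : AreaForm M) (F G : M → ℝ) {J : M → ℝ}
    (hJ : Continuous J) : IsFiniteMeasure (positivePush σ F G J) := by
  have := isFiniteMeasure_withDensity_ofReal (integrable_of_continuous σ hJ).2
  unfold positivePush
  infer_instance

/-- The map `(F, G)` has degree zero: it pushes the positive and the negative part of `dF ∧ dG` to
the same measure. -/
theorem positivePush_eq (σ : AreaForm M) {F G : M → ℝ} (hF : ContMDiff (𝓡 2) 𝓘(ℝ, ℝ) ∞ F)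
    (hG : ContMDiff (𝓡 2) 𝓘(ℝ, ℝ) ∞ G) :
    positivePush σ F G (poissonBracket σ F G) =
      positivePush σ F G (fun x => -poissonBracket σ F G x) := by
  have hJ := continuous_poissonBracket σ hF hG
  have hFc := hF.continuous
  have hGc := hG.continuous
  have := isFiniteMeasure_positivePush σ F G hJ
  have := isFiniteMeasure_positivePush σ F G (J := fun x => -poissonBracket σ F G x) hJ.neg
  -- As `max J 0 - max (-J) 0 = J`, the characteristic functions differ by the Fourier integral of
  -- `J`, which vanishes.
  refine Measure.ext_of_charFun (funext fun t => ?_)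
  rw [charFun_positivePush σ hFc hGc hJ, charFun_positivePush σ hFc hGc (J := fun x => -poissonBracket σ F G x) hJ.neg, ← sub_eq_zero,
    ← integral_sub (integrable_of_continuous σ (by fun_prop))
      (integrable_of_continuous σ (by fun_prop)),
    ← integral_cexp_mul_poissonBracket σ hF hG (t 0) (t 1)]
  refine integral_congr_ae (Filter.Eventually.of_forall fun x => ?_)
  simp only
  rw [← sub_mul, ← Complex.ofReal_sub, max_zero_sub_eq_self]

theorem positivePush_apply (σ : AreaForm M) {F G : M → ℝ} (J : M → ℝ) (hF : Continuous F)
    (hG : Continuous G) {A : Set Plane} (hA : MeasurableSet A) :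
    positivePush σ F G J A = ∫⁻ x in pairMap F G ⁻¹' A, ENNReal.ofReal (J x) ∂areaMeasure σ := by
  rw [positivePush, Measure.map_apply (continuous_pairMap hF hG).measurable hA,
    withDensity_apply _ ((continuous_pairMap hF hG).measurable hA)]

/-- A measurable set covered by `(F, G)` is covered at least twice, counted with area. -/
theorem two_mul_volume_le (σ : AreaForm M) {F G : M → ℝ} (hF : ContMDiff (𝓡 2) 𝓘(ℝ, ℝ) ∞ F)
    (hG : ContMDiff (𝓡 2) 𝓘(ℝ, ℝ) ∞ G) {T : Set Plane} (hT : MeasurableSet T)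
    (hcover : T ⊆ Set.range (pairMap F G)) :
    2 * volume T ≤ ∫⁻ x, ENNReal.ofReal |poissonBracket σ F G x| ∂areaMeasure σ := by
  set J := poissonBracket σ F G with hJdef
  have hJ : Continuous J := continuous_poissonBracket σ hF hG
  have hΦ := continuous_pairMap hF.continuous hG.continuous
  let P : Set M := {x | 0 < J x}
  have hP : MeasurableSet P := (isOpen_lt continuous_const hJ).measurableSet
  let B : Set Plane := pairMap F G '' P
  have hB : MeasurableSet B := by
    -- The image of an open set need not be open, but `P` is a countable union of compact sets, so
    -- its image is Borel.
    have hPeq : P = ⋃ n : ℕ, {x | 1 / ((n : ℝ) + 1) ≤ J x} := by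
      ext x
      simp only [P, Set.mem_ofPred_eq, Set.mem_iUnion]
      constructor
      · intro hx
        obtain ⟨n, hn⟩ := exists_nat_one_div_lt hx
        exact ⟨n, hn.le⟩
      · rintro ⟨n, hn⟩
        exact lt_of_lt_of_le Nat.one_div_pos_of_nat hn
    simp only [B]
    rw [hPeq, Set.image_iUnion]
    exact MeasurableSet.iUnion fun n =>
      ((isClosed_le continuous_const hJ).isCompact.image hΦ).measurableSet
  have h1 : volume (T ∩ B) ≤ positivePush σ F G J (T ∩ B) := by
    have hS : MeasurableSet (P ∩ pairMap F G ⁻¹' (T ∩ B)) :=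
      hP.inter (hΦ.measurable (hT.inter hB))
    rw [positivePush_apply σ J hF.continuous hG.continuous (hT.inter hB)]
    calc volume (T ∩ B) ≤ volume (pairMap F G '' (P ∩ pairMap F G ⁻¹' (T ∩ B))) := by
          refine measure_mono ?_
          rintro _ ⟨hyT, x, hx, rfl⟩
          exact ⟨x, ⟨hx, hyT, x, hx, rfl⟩, rfl⟩
      _ ≤ ∫⁻ x in P ∩ pairMap F G ⁻¹' (T ∩ B), ENNReal.ofReal |J x| ∂areaMeasure σ :=
          volume_image_pairMap_le σ hF hG hS
      _ = ∫⁻ x in P ∩ pairMap F G ⁻¹' (T ∩ B), ENNReal.ofReal (J x) ∂areaMeasure σ :=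
          setLIntegral_congr_fun hS fun x hx => by
            have h : 0 < J x := hx.1
            simp only [abs_of_pos h]
      _ ≤ _ := lintegral_mono_set Set.inter_subset_right
  -- Points of `T` outside `B` have preimages, all with `J ≤ 0`. They are thus covered by the
  -- negative part, which degree zero trades for the positive part.
  have h2 : volume (T \ B) ≤ positivePush σ F G J (T \ B) := by
    have hS : MeasurableSet (Pᶜ ∩ pairMap F G ⁻¹' (T \ B)) :=
      hP.compl.inter (hΦ.measurable (hT.diff hB))
    rw [hJdef, positivePush_eq σ hF hG, ← hJdef,
      positivePush_apply σ _ hF.continuous hG.continuous (hT.diff hB)]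
    calc volume (T \ B) ≤ volume (pairMap F G '' (Pᶜ ∩ pairMap F G ⁻¹' (T \ B))) := by
          refine measure_mono ?_
          rintro y ⟨hyT, hyB⟩
          obtain ⟨x, rfl⟩ := hcover hyT
          exact ⟨x, ⟨fun hx => hyB ⟨x, hx, rfl⟩, hyT, hyB⟩, rfl⟩
      _ ≤ ∫⁻ x in Pᶜ ∩ pairMap F G ⁻¹' (T \ B), ENNReal.ofReal |J x| ∂areaMeasure σ :=
          volume_image_pairMap_le σ hF hG hS
      _ = ∫⁻ x in Pᶜ ∩ pairMap F G ⁻¹' (T \ B), ENNReal.ofReal (-J x) ∂areaMeasure σ :=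
          setLIntegral_congr_fun hS fun x hx => by
            have h : J x ≤ 0 := not_lt.1 hx.1
            simp only [abs_of_nonpos h]
      _ ≤ _ := lintegral_mono_set Set.inter_subset_right
  -- So the positive part alone has mass at least `vol T`; by degree zero so has the negative part,
  -- and the two masses add up to `∫ |J|`.
  have h3 : volume T ≤ positivePush σ F G J Set.univ := by
    rw [← measure_inter_add_sdiff T hB]
    refine (add_le_add h1 h2).trans ?_
    rw [measure_inter_add_sdiff T hB]
    exact measure_mono (Set.subset_univ _)
  have h4 : volume T ≤ positivePush σ F G (fun x => -J x) Set.univ := by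
    rwa [← positivePush_eq σ hF hG]
  rw [positivePush_apply σ _ hF.continuous hG.continuous MeasurableSet.univ, Set.preimage_univ,
    Measure.restrict_univ] at h3 h4
  rw [two_mul]
  refine (add_le_add h3 h4).trans ?_
  rw [← lintegral_add_left hJ.measurable.ennreal_ofReal]
  refine lintegral_mono fun x => ?_
  rcases le_total 0 (J x) with h | h
  · simp [abs_of_nonneg h, ENNReal.ofReal_of_nonpos (neg_nonpos.2 h)]
  · simp [abs_of_nonpos h, ENNReal.ofReal_of_nonpos h]

omit [T2Space M] [MeasurableSpace M] [BorelSpace M] in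
theorem abs_poissonBracket_le_supNorm (σ : AreaForm M) {F G : M → ℝ}
    (hF : ContMDiff (𝓡 2) 𝓘(ℝ, ℝ) ∞ F) (hG : ContMDiff (𝓡 2) 𝓘(ℝ, ℝ) ∞ G) (x : M) :
    |poissonBracket σ F G x| ≤ supNorm (poissonBracket σ F G) :=
  le_ciSup (isCompact_range (continuous_poissonBracket σ hF hG).abs).bddAbove x

theorem lintegral_abs_poissonBracket_le (σ : AreaForm M) {F G : M → ℝ}
    (hF : ContMDiff (𝓡 2) 𝓘(ℝ, ℝ) ∞ F) (hG : ContMDiff (𝓡 2) 𝓘(ℝ, ℝ) ∞ G) :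
    ∫⁻ x, ENNReal.ofReal |poissonBracket σ F G x| ∂areaMeasure σ ≤
      ENNReal.ofReal (area σ * supNorm (poissonBracket σ F G)) := by
  refine (lintegral_mono fun x => ENNReal.ofReal_le_ofReal
    (abs_poissonBracket_le_supNorm σ hF hG x)).trans_eq ?_
  rw [lintegral_const, areaMeasure_univ, mul_comm, ENNReal.ofReal_mul (area_nonneg σ)]

end AreaFormula

/-! ### The area of the triangle -/

section Triangle

theorem isOpen_triangle (a b c : ℝ) :
    IsOpen {y : Plane | a < y 0 ∧ b < y 1 ∧ y 0 + y 1 < c} := by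
  have h0 : Continuous fun y : Plane => y 0 := by fun_prop
  have h1 : Continuous fun y : Plane => y 1 := by fun_prop
  exact (isOpen_lt continuous_const h0).inter
    ((isOpen_lt continuous_const h1).inter (isOpen_lt (h0.add h1) continuous_const))

theorem volume_triangle {a b c : ℝ} (h : a + b ≤ c) :
    volume {y : Plane | a < y 0 ∧ b < y 1 ∧ y 0 + y 1 < c} =
      ENNReal.ofReal ((c - a - b) ^ 2 / 2) := by
  have hmp := (PiLp.volume_preserving_toLp (Fin 2)).comp
    (volume_preserving_finTwoArrow ℝ).symm
  rw [← hmp.measure_preimage (isOpen_triangle a b c).measurableSet.nullMeasurableSet]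
  have hset : (WithLp.toLp 2 ∘ (MeasurableEquiv.finTwoArrow (α := ℝ)).symm) ⁻¹'
      {y : Plane | a < y 0 ∧ b < y 1 ∧ y 0 + y 1 < c} =
      regionBetween (fun _ => b) (fun x => c - x) (Set.Ioo a (c - b)) := by
    ext ⟨x, y⟩
    simp only [regionBetween, Set.mem_preimage, Set.mem_ofPred_eq, Set.mem_Ioo,
      Function.comp_apply, MeasurableEquiv.finTwoArrow]
    constructor
    · rintro ⟨h1, h2, h3⟩
      change a < x at h1
      change b < y at h2
      change x + y < c at h3
      exact ⟨⟨h1, by linarith⟩, h2, by linarith⟩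
    · rintro ⟨⟨h1, -⟩, h2, h3⟩
      exact ⟨h1, h2, show x + y < c by linarith⟩
  rw [hset, Measure.volume_eq_prod, volume_regionBetween_eq_integral
    (integrableOn_const (by simp))
    ((by fun_prop : Continuous fun x : ℝ => c - x).integrableOn_Icc.mono_set Set.Ioo_subset_Icc_self)
    measurableSet_Ioo (fun x hx => by have := hx.2; linarith)]
  congr 1
  rw [← integral_Ioc_eq_integral_Ioo, ← intervalIntegral.integral_of_le (by linarith)]
  have : ∫ x in a..(c - b), ((fun x : ℝ => c - x) - fun _ : ℝ => b) x = ∫ x in a..(c - b), (c - b - x) := by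
    refine intervalIntegral.integral_congr fun x _ => ?_
    simp only [Pi.sub_apply]
    ring
  rw [this, intervalIntegral.integral_sub (by simp) (by simp)]
  simp
  ring

end Triangle

/-! ### The inequality -/

theorem sq_le_area_mul_supNorm {M : Type*} [TopologicalSpace M] [T2Space M] [CompactSpace M]
    [ChartedSpace Plane M] [IsManifold (𝓡 2) ∞ M] (σ : AreaForm M) {ζ : C(M, ℝ) → ℝ}
    (hζ : IsSimple ζ) (F G : C(M, ℝ)) (hF : ContMDiff (𝓡 2) 𝓘(ℝ, ℝ) ∞ F)
    (hG : ContMDiff (𝓡 2) 𝓘(ℝ, ℝ) ∞ G) (hd : 0 ≤ ζ (F + G) - ζ F - ζ G) :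
    (ζ (F + G) - ζ F - ζ G) ^ 2 ≤ area σ * supNorm (poissonBracket σ F G) := by
  borelize M
  let T : Set Plane := {y | ζ F < y 0 ∧ ζ G < y 1 ∧ y 0 + y 1 < ζ (F + G)}
  have hopen : IsOpen T := isOpen_triangle _ _ _
  have hcover : T ⊆ Set.range (pairMap F G) := by
    rintro y ⟨h1, h2, h3⟩
    obtain ⟨x, hx1, hx2⟩ := hζ.exists_eq_of_mem_triangle F G h1 h2 h3
    refine ⟨x, ?_⟩
    ext i
    fin_cases i
    · exact hx1
    · exact hx2
  -- The factor 2 from double covering cancels the 1/2 in the area of the triangle.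
  have h := (two_mul_volume_le σ hF hG hopen.measurableSet hcover).trans
    (lintegral_abs_poissonBracket_le σ hF hG)
  have hnn : 0 ≤ area σ * supNorm (poissonBracket σ F G) :=
    mul_nonneg (area_nonneg σ) (Real.iSup_nonneg fun _ => abs_nonneg _)
  have h2 : (2 : ENNReal) = ENNReal.ofReal 2 := by simp
  rw [volume_triangle (by linarith), h2, ← ENNReal.ofReal_mul (by norm_num),
    ENNReal.ofReal_le_ofReal_iff hnn] at h
  linarith

end SimpleQuasiState

end

theorem theorem1p2 {M : Type*} [TopologicalSpace M] [T2Space M] [CompactSpace M]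
    [ChartedSpace (EuclideanSpace ℝ (Fin 2)) M] [IsManifold (𝓡 2) ∞ M]
    (σ : SimpleQuasiState.AreaForm M)
    (ζ : C(M, ℝ) → ℝ) (hζ : SimpleQuasiState.IsSimple ζ)
    (F G : C^∞⟮𝓡 2, M; 𝓘(ℝ, ℝ), ℝ⟯) :
    SimpleQuasiState.nonadditivity ζ (F : C(M, ℝ)) (G : C(M, ℝ)) ^ 2 ≤
      SimpleQuasiState.area σ *
        SimpleQuasiState.supNorm (SimpleQuasiState.poissonBracket σ F G) := by
  rw [SimpleQuasiState.nonadditivity, sq_abs]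
  rcases le_total 0 (ζ ((F : C(M, ℝ)) + (G : C(M, ℝ))) - ζ F - ζ G) with h | h
  · exact SimpleQuasiState.sq_le_area_mul_supNorm σ hζ F G F.contMDiff G.contMDiff h
  -- If the defect is negative, passing to `(-F, -G)` reverses its sign and keeps the bracket.
  · have e : ζ (-(F : C(M, ℝ)) + -(G : C(M, ℝ))) - ζ (-(F : C(M, ℝ))) - ζ (-(G : C(M, ℝ))) =
        -(ζ ((F : C(M, ℝ)) + (G : C(M, ℝ))) - ζ F - ζ G) := by
      rw [← neg_add, hζ.map_neg, hζ.map_neg, hζ.map_neg]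
      ring
    have h1 := SimpleQuasiState.sq_le_area_mul_supNorm σ hζ (-(F : C(M, ℝ))) (-(G : C(M, ℝ)))
      F.contMDiff.neg G.contMDiff.neg (by rw [e]; linarith)
    rw [e, neg_sq] at h1
    have e2 : SimpleQuasiState.poissonBracket σ (-(F : C(M, ℝ)) : C(M, ℝ))
        (-(G : C(M, ℝ)) : C(M, ℝ)) = SimpleQuasiState.poissonBracket σ F G :=
      funext fun x => SimpleQuasiState.poissonBracket_neg_neg σ F G x
    rwa [e2] at h1
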